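/- Let $\Lambda\subset\mathbb C^n$ be a lattice (a discrete subgroup spanning $\mathbb C^n$ over $\mathbb R$), let $\mathbb T=\mathbb C^n/\Lambda$ with projection $\Pi:\mathbb C^n\to\mathbb T$, and let $\omega$ be the Hermitian form on $\mathbb T$ induced by $\frac i2\sum_{j=1}^n dz_j\wedge d\bar z_j$. *Definitions.* For a nonconstant holomorphic disc $F:\overline{\mathbb D}(z_0,R)\to\mathbb T$, smooth up to the boundary, put (lengths and areas being counted with multiplicity) $$A(F)=\int_{\mathbb D(z_0,R)}F^*\omega,\quad L(F)=\mathrm{Length}_\omega F(\partial\mathbb D(z_0,R)),\quad \langle\widehat{\mathcal N}_F,\phi\rangle=\int_0^R\frac{dt}t\int_{\mathbb D(z_0,t)}F^*\phi,\quad \mathfrak L(F)=\int_0^R\mathrm{Length}_\omega F(\partial\mathbb D(z_0,t))\,\frac{dt}t ,$$ and $\mathfrak A(F)=\langle\widehat{\mathcal N}_F,\omega\rangle$. Let $\mathcal T$ be a current of dimension $2$ on $\mathbb T$. It is an *Ahlfors current* if there is a sequence of such discs $F_j$ with $L(F_j)/A(F_j)\to0$ and $\frac1{A(F_j)}\int F_j^*\phi\to\langle\mathcal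 T,\phi\rangle$ for every smooth $2$-form $\phi$. It is a *Nevanlinna current* if there is such a sequence with $\mathfrak L(F_j)/\mathfrak A(F_j)\to0$ and $\frac1{\mathfrak A(F_j)}\langle\widehat{\mathcal N}_{F_j},\phi\rangle\to\langle\mathcal T,\phi\rangle$ for every smooth $2$-form $\phi$. Such a current is *produced by an entire curve* $f:\mathbb C\to\mathbb T$ if one can take $F_j=f|_{\overline{\mathbb D}(0,r_j)}$ with radii $r_j$ increasing to $\infty$. For $v\in\mathbb C^n\setminus\{0\}$, write $\mathcal T_{[v]}$ for any Ahlfors or Nevanlinna current produced by an affine curve $z\mapsto\Pi(zv+c)$, $c\in\mathbb C^n$. Let $\mathcal C$ be the convex cone generated by all the currents $\mathcal T_{[v]}$, and let $\mathcal C_1=\{T\in\mathcal C:\langle T,\omega\rangle=1\}$. Two closed currents are *cohomologous* if their difference is $dS$ for some current $S$. **Proposition.** For every Nevanlinna or Ahlfors current $\mathcal T$ on $\mathbb T$ there are an orthonormal basis $\{v_s\}_{s=1}^n$ of $\mathbb C^n$ and real numbers $\beta_1,\dots,\beta_n\ge0$ with $\sum_{s=1}^n\beta_s=1$ (depending on $\mathcal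 T$) such that the following hold. For every $s$ and every $c\in\mathbb C^n$ the curve $z\mapsto\Pi(zv_s+c)$ produces both an Ahlfors current and a Nevanlinna current. For any choice of the currents $\mathcal T_{[v_s]}$, the current $$T'=\sum_{s=1}^n\beta_s\,\mathcal T_{[v_s]}$$ lies in $\mathcal C_1$, both $\mathcal T$ and $T'$ are closed, and $T'$ is cohomologous to $\mathcal T$. -/

import Mathlib

open Filter Topology MeasureTheory Metric
open scoped ContDiff NNReal

noncomputable section

namespace ComplexTorus

/-- The complex Euclidean space `ℂⁿ`, with the Euclidean norm. -/
abbrev Cn (n : ℕ) : Type := EuclideanSpace ℂ (Fin n)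

/-- The complex torus `𝕋 = ℂⁿ / Λ`. -/
abbrev Torus {n : ℕ} (Λ : Submodule ℤ (Cn n)) : Type := Cn n ⧸ Λ

/-- The canonical projection `Π : ℂⁿ → 𝕋`. -/
def proj {n : ℕ} (Λ : Submodule ℤ (Cn n)) (x : Cn n) : Torus Λ := Submodule.Quotient.mk x

theorem proj_add_mem {n : ℕ} {Λ : Submodule ℤ (Cn n)} {l : Cn n} (hl : l ∈ Λ) (x : Cn n) :
    proj Λ (x + l) = proj Λ x := by
  rw [proj, proj, Submodule.Quotient.eq]
  simpa using hl

/-! ### Smooth differential forms on the torus -/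

/-- Smooth complex-valued differential `k`-forms on `𝕋`. The projection `Π` identifies every
(real) tangent space of `𝕋` with `ℂⁿ`, so a `k`-form is a map from `𝕋` to the real-multilinear
alternating maps on `ℂⁿ`; it is smooth if its pullback to `ℂⁿ` by the local diffeomorphism `Π` is
smooth. -/
def smoothForms {n : ℕ} (Λ : Submodule ℤ (Cn n)) (k : ℕ) :
    Submodule ℂ (Torus Λ → Cn n [⋀^Fin k]→L[ℝ] ℂ) where
  carrier := {φ | ContDiff ℝ ∞ (fun x => φ (proj Λ x))}
  add_mem' {φ ψ} hφ hψ := by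
    rw [Set.mem_ofPred_eq] at hφ hψ ⊢
    exact hφ.add hψ
  zero_mem' := by
    rw [Set.mem_ofPred_eq]
    exact contDiff_const
  smul_mem' c φ hφ := by
    rw [Set.mem_ofPred_eq] at hφ ⊢
    exact hφ.const_smul c

/-- The pullback of a form on `𝕋` to `ℂⁿ` by `Π`. -/
def lift {n : ℕ} {Λ : Submodule ℤ (Cn n)} {k : ℕ} (φ : smoothForms Λ k) :
    Cn n → Cn n [⋀^Fin k]→L[ℝ] ℂ :=
  fun x => φ.1 (proj Λ x)

theorem contDiff_lift {n : ℕ} {Λ : Submodule ℤ (Cn n)} {k : ℕ} (φ : smoothForms Λ k) :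
    ContDiff ℝ ∞ (lift φ) :=
  φ.2

theorem extDeriv_lift_add_mem {n : ℕ} {Λ : Submodule ℤ (Cn n)} {k : ℕ} (φ : smoothForms Λ k)
    {l : Cn n} (hl : l ∈ Λ) (x : Cn n) :
    _root_.extDeriv (lift φ) (x + l) = _root_.extDeriv (lift φ) x := by
  have h : (fun y => lift φ (y + l)) = lift φ := by
    funext y
    simp only [lift, proj_add_mem hl]
  unfold _root_.extDeriv
  rw [← fderiv_comp_add_right (f := lift φ) l, h]

/-- The exterior derivative, as a map on the torus: at `Π x` it is the exterior derivative at `x`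
of the pullback to `ℂⁿ`. -/
def extDerivFun {n : ℕ} {Λ : Submodule ℤ (Cn n)} {k : ℕ} (φ : smoothForms Λ k) :
    Torus Λ → Cn n [⋀^Fin (k + 1)]→L[ℝ] ℂ :=
  fun p => _root_.extDeriv (lift φ) (Quotient.out p)

theorem extDerivFun_proj {n : ℕ} {Λ : Submodule ℤ (Cn n)} {k : ℕ} (φ : smoothForms Λ k)
    (x : Cn n) : extDerivFun φ (proj Λ x) = _root_.extDeriv (lift φ) x := by
  have h : proj Λ (Quotient.out (proj Λ x)) = proj Λ x := Quotient.out_eq _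
  have h' : Quotient.out (proj Λ x) - x ∈ Λ := by
    rwa [proj, proj, Submodule.Quotient.eq] at h
  have := extDeriv_lift_add_mem φ h' x
  rwa [add_sub_cancel] at this

/-- The exterior derivative `d` on smooth forms on the torus. -/
def d {n : ℕ} {Λ : Submodule ℤ (Cn n)} {k : ℕ} :
    smoothForms Λ k →ₗ[ℂ] smoothForms Λ (k + 1) where
  toFun φ := ⟨extDerivFun φ, by
    have h : (fun x => extDerivFun φ (proj Λ x)) = _root_.extDeriv (lift φ) :=
      funext (extDerivFun_proj φ)
    change ContDiff ℝ ∞ (fun x => extDerivFun φ (proj Λ x))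
    rw [h]
    exact (ContinuousAlternatingMap.alternatizeUncurryFinCLM ℝ (Cn n) ℂ).contDiff.comp
      ((contDiff_lift φ).fderiv_right (m := ∞) (by simp))⟩
  map_add' φ ψ := by
    ext1
    funext p
    exact extDeriv_add ((contDiff_lift φ).differentiable (by simp) _)
      ((contDiff_lift ψ).differentiable (by simp) _)
  map_smul' c φ := by
    ext1
    funext p
    change _root_.extDeriv (c • lift φ) _ = c • _root_.extDeriv (lift φ) _
    unfold _root_.extDeriv
    rw [fderiv_const_smul ((contDiff_lift φ).differentiable (by simp) _)]
    exact ContinuousAlternatingMap.alternatizeUncurryFin_smul c _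

/-- The alternating form `(i/2) ∑ⱼ dzⱼ ∧ dz̄ⱼ` on `ℂⁿ`. -/
def stdForm (n : ℕ) : Cn n [⋀^Fin 2]→L[ℝ] ℂ where
  toFun u := Complex.I / 2 * ∑ j, (u 0 j * star (u 1 j) - u 1 j * star (u 0 j))
  map_update_add' u i x y := by
    fin_cases i <;> simp [mul_add, add_mul, Finset.sum_add_distrib, Function.update] <;> ring
  map_update_smul' u i a x := by
    fin_cases i <;> simp [Function.update, mul_assoc, mul_left_comm _ (a : ℂ), ← Finset.mul_sum,
      ← mul_sub]
  map_eq_zero_of_eq' u i j h hij := by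
    fin_cases i <;> fin_cases j <;> simp_all
  cont := by fun_prop

/-- The Hermitian form `ω` on `𝕋` induced by the standard Euclidean form
`(i/2) ∑ⱼ dzⱼ ∧ dz̄ⱼ` on `ℂⁿ`. -/
def omega {n : ℕ} (Λ : Submodule ℤ (Cn n)) : smoothForms Λ 2 :=
  ⟨fun _ => stdForm n, by
    change ContDiff ℝ ∞ (fun _ => stdForm n)
    exact contDiff_const⟩

/-! ### Currents -/

/-- The space of currents of dimension `k` on `𝕋` (that is, of degree `2n - k`): linear functionals
on the smooth complex `k`-forms that are continuous for the `C^∞` topology, i.e. bounded by a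
constant times the `C^N`-norm for some `N`. -/
def currents {n : ℕ} (Λ : Submodule ℤ (Cn n)) (k : ℕ) :
    Submodule ℂ (Module.Dual ℂ (smoothForms Λ k)) where
  carrier := {T | ∃ (N : ℕ) (C : ℝ), ∀ (φ : smoothForms Λ k) (B : ℝ),
    (∀ m ≤ N, ∀ x, ‖iteratedFDeriv ℝ m (lift φ) x‖ ≤ B) → ‖T φ‖ ≤ C * B}
  add_mem' := by
    rintro S T ⟨N, C, h⟩ ⟨N', C', h'⟩
    refine ⟨max N N', C + C', fun φ B hB => ?_⟩
    have h1 := h φ B (fun m hm => hB m (hm.trans (le_max_left _ _)))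
    have h2 := h' φ B (fun m hm => hB m (hm.trans (le_max_right _ _)))
    calc ‖(S + T) φ‖ ≤ ‖S φ‖ + ‖T φ‖ := norm_add_le _ _
      _ ≤ (C + C') * B := by linarith
  zero_mem' := ⟨0, 0, fun φ B _ => by simp⟩
  smul_mem' := by
    rintro c T ⟨N, C, h⟩
    refine ⟨N, ‖c‖ * C, fun φ B hB => ?_⟩
    calc ‖(c • T) φ‖ = ‖c‖ * ‖T φ‖ := norm_mul c (T φ)
      _ ≤ ‖c‖ * (C * B) := mul_le_mul_of_nonneg_left (h φ B hB) (norm_nonneg _)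
      _ = ‖c‖ * C * B := by ring

/-- A current `T` is closed if `⟨T, dφ⟩ = 0` for all smooth forms `φ`. -/
def IsClosedCurrent {n : ℕ} {Λ : Submodule ℤ (Cn n)} {k : ℕ} (T : currents Λ (k + 1)) : Prop :=
  ∀ φ : smoothForms Λ k, T.1 (d φ) = 0

/-- A current `T` is exact if `T = dS` for some current `S`, that is `⟨T, φ⟩ = ⟨S, dφ⟩` for all
smooth forms `φ` (the sign in the definition of `dS` is absorbed in `S`). -/
def IsExactCurrent {n : ℕ} {Λ : Submodule ℤ (Cn n)} {k : ℕ} (T : currents Λ k) : Prop :=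
  ∃ S : currents Λ (k + 1), ∀ φ : smoothForms Λ k, T.1 φ = S.1 (d φ)

/-- Two currents represent the same de Rham cohomology class: both are closed and their difference
is exact. -/
def Cohomologous {n : ℕ} {Λ : Submodule ℤ (Cn n)} {k : ℕ} (T T' : currents Λ (k + 1)) : Prop :=
  IsClosedCurrent T ∧ IsClosedCurrent T' ∧ IsExactCurrent (T - T')

/-! ### Holomorphic discs in the torus -/

/-- `L` is the (real) differential at `z` of the map `F` from `s ⊆ ℂ` to the torus: it is the
differential of a local lift of `F` to `ℂⁿ`. -/
def HasFDerivWithin {n : ℕ} {Λ : Submodule ℤ (Cn n)} (F : ℂ → Torus Λ) (L : ℂ →L[ℝ] Cn n)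
    (s : Set ℂ) (z : ℂ) : Prop :=
  ∃ f : ℂ → Cn n, HasFDerivWithinAt f L s z ∧ ∀ᶠ w in 𝓝[s] z, F w = proj Λ (f w)

open Classical in
/-- The differential at `z` of a map `F` from `s ⊆ ℂ` to the torus (zero where there is none). -/
def fderivTorus {n : ℕ} {Λ : Submodule ℤ (Cn n)} (F : ℂ → Torus Λ) (s : Set ℂ) (z : ℂ) :
    ℂ →L[ℝ] Cn n :=
  if h : ∃ L, HasFDerivWithin F L s z then h.choose else 0

/-- `F` is smooth at `z` as a map from `s` to the torus: it has a smooth local lift. -/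
def SmoothWithinAt {n : ℕ} {Λ : Submodule ℤ (Cn n)} (F : ℂ → Torus Λ) (s : Set ℂ) (z : ℂ) :
    Prop :=
  ∃ f : ℂ → Cn n, ContDiffWithinAt ℝ ∞ f s z ∧ ∀ᶠ w in 𝓝[s] z, F w = proj Λ (f w)

/-- `F` is holomorphic near `z`: it has a holomorphic local lift. -/
def HolomorphicAt {n : ℕ} {Λ : Submodule ℤ (Cn n)} (F : ℂ → Torus Λ) (z : ℂ) : Prop :=
  ∃ f : ℂ → Cn n, (∀ᶠ w in 𝓝 z, DifferentiableAt ℂ f w) ∧ ∀ᶠ w in 𝓝 z, F w = proj Λ (f w)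

/-- A nonconstant holomorphic disc `F : 𝔻̄(z₀, R) → 𝕋`, smooth up to the boundary. Only the values
of `toFun` on the closed disc are relevant. -/
structure HolDisc {n : ℕ} (Λ : Submodule ℤ (Cn n)) where
  center : ℂ
  radius : ℝ
  radius_pos : 0 < radius
  toFun : ℂ → Torus Λ
  smooth : ∀ z ∈ closedBall center radius, SmoothWithinAt toFun (closedBall center radius) z
  holomorphic : ∀ z ∈ ball center radius, HolomorphicAt toFun z
  nonconstant : ∃ z ∈ closedBall center radius, ∃ w ∈ closedBall center radius,
    toFun z ≠ toFun w

namespace HolDisc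

/-- The differential of the disc at a point of the closed disc. -/
def deriv {n : ℕ} {Λ : Submodule ℤ (Cn n)} (D : HolDisc Λ) (z : ℂ) : ℂ →L[ℝ] Cn n :=
  fderivTorus D.toFun (closedBall D.center D.radius) z

/-- The pullback `F^*φ` of a 2-form, as a form on the closed disc. -/
def pullback {n : ℕ} {Λ : Submodule ℤ (Cn n)} (D : HolDisc Λ) (φ : smoothForms Λ 2) (z : ℂ) :
    ℂ [⋀^Fin 2]→L[ℝ] ℂ :=
  (φ.1 (D.toFun z)).compContinuousLinearMap (D.deriv z)

/-- `∫_{𝔻(z₀, t)} F^*φ`, for `0 < t ≤ R`. -/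
def integral {n : ℕ} {Λ : Submodule ℤ (Cn n)} (D : HolDisc Λ) (t : ℝ) (φ : smoothForms Λ 2) : ℂ :=
  ∫ z in ball D.center t, D.pullback φ z ![1, Complex.I]

/-- The length for `ω` of the curve `F(∂𝔻(z₀, t))`, for `0 < t ≤ R`. -/
def length {n : ℕ} {Λ : Submodule ℤ (Cn n)} (D : HolDisc Λ) (t : ℝ) : ℝ :=
  ∫ θ in (0 : ℝ)..(2 * Real.pi),
    ‖D.deriv (circleMap D.center t θ) (circleMap 0 t θ * Complex.I)‖

/-- The area `∫_{𝔻(z₀, R)} F^*ω` of the disc, counted with multiplicity (a positive real number). -/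
def area {n : ℕ} {Λ : Submodule ℤ (Cn n)} (D : HolDisc Λ) : ℝ :=
  (D.integral D.radius (omega Λ)).re

/-- The pairing `∫₀^R (dt/t) ∫_{𝔻(z₀, t)} F^*φ`. -/
def jensen {n : ℕ} {Λ : Submodule ℤ (Cn n)} (D : HolDisc Λ) (φ : smoothForms Λ 2) : ℂ :=
  ∫ t in (0 : ℝ)..D.radius, (t : ℂ)⁻¹ * D.integral t φ

/-- `∫₀^R (dt/t) ∫_{𝔻(z₀, t)} F^*ω` (a positive real number). -/
def nevArea {n : ℕ} {Λ : Submodule ℤ (Cn n)} (D : HolDisc Λ) : ℝ :=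
  (D.jensen (omega Λ)).re

/-- `∫₀^R Length(F(∂𝔻(z₀, t))) dt/t`. -/
def nevLength {n : ℕ} {Λ : Submodule ℤ (Cn n)} (D : HolDisc Λ) : ℝ :=
  ∫ t in (0 : ℝ)..D.radius, t⁻¹ * D.length t

end HolDisc

/-! ### Ahlfors and Nevanlinna currents

Currents are paired here with all complex 2-forms. The pullback of a form of type `(2,0)` or `(0,2)`
to a holomorphic disc vanishes, so all limits below have bidimension `(1,1)`. -/

/-- The sequence of discs satisfies the length-area condition, and its normalized currents of
integration converge weakly to `T`. -/
def AhlforsLimit {n : ℕ} {Λ : Submodule ℤ (Cn n)} (D : ℕ → HolDisc Λ) (T : currents Λ 2) : Prop :=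
  Tendsto (fun j => (D j).length (D j).radius / (D j).area) atTop (𝓝 0) ∧
  ∀ φ : smoothForms Λ 2,
    Tendsto (fun j => ((D j).area : ℂ)⁻¹ * (D j).integral (D j).radius φ) atTop (𝓝 (T.1 φ))

/-- The sequence of discs satisfies the Nevanlinna length-area condition, and its normalized
Nevanlinna (Jensen type) currents converge weakly to `T`. -/
def NevanlinnaLimit {n : ℕ} {Λ : Submodule ℤ (Cn n)} (D : ℕ → HolDisc Λ) (T : currents Λ 2) :
    Prop :=
  Tendsto (fun j => (D j).nevLength / (D j).nevArea) atTop (𝓝 0) ∧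
  ∀ φ : smoothForms Λ 2,
    Tendsto (fun j => ((D j).nevArea : ℂ)⁻¹ * (D j).jensen φ) atTop (𝓝 (T.1 φ))

/-- `T` is an Ahlfors current on `𝕋`. -/
def IsAhlforsCurrent {n : ℕ} {Λ : Submodule ℤ (Cn n)} (T : currents Λ 2) : Prop :=
  ∃ D : ℕ → HolDisc Λ, AhlforsLimit D T

/-- `T` is a Nevanlinna current on `𝕋`. -/
def IsNevanlinnaCurrent {n : ℕ} {Λ : Submodule ℤ (Cn n)} (T : currents Λ 2) : Prop :=
  ∃ D : ℕ → HolDisc Λ, NevanlinnaLimit D T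

/-- The discs `D j` are the restrictions of `F : ℂ → 𝕋` to closed discs centred at the origin
whose radii increase to infinity. -/
def Exhausts {n : ℕ} {Λ : Submodule ℤ (Cn n)} (D : ℕ → HolDisc Λ) (F : ℂ → Torus Λ) : Prop :=
  (∀ j, (D j).center = 0 ∧ (D j).toFun = F) ∧
  StrictMono (fun j => (D j).radius) ∧ Tendsto (fun j => (D j).radius) atTop atTop

/-- `T` is an Ahlfors current produced by the entire curve `F`. -/
def IsAhlforsCurrentOf {n : ℕ} {Λ : Submodule ℤ (Cn n)} (F : ℂ → Torus Λ) (T : currents Λ 2) :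
    Prop :=
  ∃ D : ℕ → HolDisc Λ, Exhausts D F ∧ AhlforsLimit D T

/-- `T` is a Nevanlinna current produced by the entire curve `F`. -/
def IsNevanlinnaCurrentOf {n : ℕ} {Λ : Submodule ℤ (Cn n)} (F : ℂ → Torus Λ) (T : currents Λ 2) :
    Prop :=
  ∃ D : ℕ → HolDisc Λ, Exhausts D F ∧ NevanlinnaLimit D T

/-- The affine entire curve `z ↦ Π(z v + c)`. -/
def affineCurve {n : ℕ} (Λ : Submodule ℤ (Cn n)) (v c : Cn n) : ℂ → Torus Λ :=
  fun z => proj Λ (z • v + c)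

/-- `T` is a representative of `𝒯_[v]`: a Nevanlinna or Ahlfors current produced by some affine
entire curve of direction `v`. -/
def IsLinearCurrent {n : ℕ} {Λ : Submodule ℤ (Cn n)} (v : Cn n) (T : currents Λ 2) : Prop :=
  ∃ c : Cn n, IsAhlforsCurrentOf (affineCurve Λ v c) T ∨ IsNevanlinnaCurrentOf (affineCurve Λ v c) T

/-- The convex cone `𝒞` generated by the currents of affine entire curves. -/
def linearCone {n : ℕ} (Λ : Submodule ℤ (Cn n)) : Submodule ℝ≥0 (currents Λ 2) :=
  Submodule.span ℝ≥0 {T | ∃ v : Cn n, v ≠ 0 ∧ IsLinearCurrent v T}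

/-- The set `𝒞₁` of the currents of mass `1` with respect to `ω` in the cone `𝒞`. -/
def linearConeOne {n : ℕ} (Λ : Submodule ℤ (Cn n)) : Set (currents Λ 2) :=
  {T | T ∈ linearCone Λ ∧ T.1 (omega Λ) = 1}

end ComplexTorus

end

/-!
A current that is a limit of normalized holomorphic discs is treated through three properties that
pass to the limit (`IsDiscMean`, `IsMeanLimit`). By Stokes' theorem the pairing of a disc with `dφ`
is bounded by the supremum of `φ` times the length of the boundary, so the length-area condition
makes the limit closed. It has mass `1` on `ω`. Finally, the tangent planes of a holomorphic disc are
complex lines, so the limit is nonnegative on every translation invariant form `c` with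
`c(v, iv) ≥ 0` for all `v`.

On the torus the cohomology class of a closed current is determined by its values on translation
invariant forms. Averaging Cartan's formula over the translations by the points of a fundamental
domain gives a homotopy operator `H`, continuous for the `C^∞` topology, such that the mean of the
translates of `φ`, a translation invariant form, equals `φ + dHφ + Hdφ` (`homotopy_formula`). If `U`
is closed and vanishes on translation invariant forms, then `U = -(U ∘ H) ∘ d`
(`isExactCurrent_of_constForm`).

The restriction of a limit current `T` to translation invariant forms is encoded by the matrix
`T((i/2) dz_a ∧ dz̄_b)`, which is positive semidefinite with trace `1`. Its spectral decomposition
`∑ β_s v_s v_s^*` gives `T(c) = ∑ β_s c(v_s, i v_s)` (`IsMeanLimit.exists_orthonormalBasis`). Discs in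
an affine curve of direction `v_s` have constant tangent plane, so every current they produce takes
the value `c(v_s, i v_s)` on `c` (`IsLinearCurrent.constPart_eq`). Hence `T` and `∑ β_s 𝒯_[v_s]` agree
on translation invariant forms. The currents `𝒯_[v_s]` exist by weak compactness
(`exists_subseq_tendsto`), since the length-area ratios of affine discs of radius `r` are `O(1/r)`.
-/

noncomputable section

namespace ComplexTorus

/-! ### Superpositions of translates of a smooth map -/

section Superposition

variable {E P : Type} [NormedAddCommGroup E] [NormedSpace ℝ E] [FiniteDimensional ℝ E]
  [TopologicalSpace P] [SecondCountableTopology P] [MeasurableSpace P] [OpensMeasurableSpace P]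
  {μ : Measure P} [IsFiniteMeasure μ] {w : P → E} {K : ℝ}

theorem hasFDerivAt_integral_translate {G G' : Type} [NormedAddCommGroup G] [NormedSpace ℝ G]
    [NormedAddCommGroup G'] [NormedSpace ℝ G'] {L : P → G →L[ℝ] G'} (hw : Continuous w)
    (hwK : ∀ᵐ p ∂μ, ‖w p‖ ≤ K) (hL : Continuous L) (hLK : ∀ᵐ p ∂μ, ‖L p‖ ≤ K)
    {g : E → G} (hg : ContDiff ℝ 1 g) (x : E) :
    HasFDerivAt (fun x => ∫ p, L p (g (x + w p)) ∂μ)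
      (∫ p, ContinuousLinearMap.compL ℝ E G G' (L p) (fderiv ℝ g (x + w p)) ∂μ) x := by
  have hK : ∀ᵐ p ∂μ, 0 ≤ K := hwK.mono fun p hp => (norm_nonneg _).trans hp
  have hg' : Continuous (fderiv ℝ g) := hg.continuous_fderiv (by simp)
  obtain ⟨C, hC⟩ := (isCompact_closedBall x (1 + K)).exists_bound_of_continuousOn
    hg.continuous.continuousOn
  obtain ⟨C', hC'⟩ := (isCompact_closedBall x (1 + K)).exists_bound_of_continuousOn
    hg'.continuousOn
  have hmem : ∀ y ∈ ball x 1, ∀ p, ‖w p‖ ≤ K → y + w p ∈ closedBall x (1 + K) := by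
    intro y hy p hp
    rw [mem_closedBall, dist_eq_norm, add_sub_right_comm]
    rw [mem_ball, dist_eq_norm] at hy
    exact (norm_add_le _ _).trans (add_le_add hy.le hp)
  have hmeas : ∀ y, AEStronglyMeasurable (fun p => L p (g (y + w p))) μ := fun y =>
    (hL.clm_apply (hg.continuous.comp (continuous_const.add hw))).aestronglyMeasurable
  refine hasFDerivAt_integral_of_dominated_of_fderiv_le (μ := μ) (s := ball x 1)
    (bound := fun _ => K * C') (F' := fun y p =>
      ContinuousLinearMap.compL ℝ E G G' (L p) (fderiv ℝ g (y + w p)))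
    (ball_mem_nhds x one_pos) (Eventually.of_forall hmeas) ?_ ?_ ?_ (integrable_const _) ?_
  · refine Integrable.of_bound (hmeas x) (K * C) ?_
    filter_upwards [hwK, hLK, hK] with p hp hp' h0
    refine ((L p).le_opNorm _).trans (mul_le_mul hp' (hC _ (hmem x (mem_ball_self one_pos) p hp))
      (norm_nonneg _) h0)
  · exact (((ContinuousLinearMap.compL ℝ E G G').continuous.comp hL).clm_apply
      (hg'.comp (continuous_const.add hw))).aestronglyMeasurable
  · filter_upwards [hwK, hLK, hK] with p hp hp' h0 y hy
    rw [ContinuousLinearMap.compL_apply]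
    exact (ContinuousLinearMap.opNorm_comp_le _ _).trans
      (mul_le_mul hp' (hC' _ (hmem y hy p hp)) (norm_nonneg _) h0)
  · refine Eventually.of_forall fun p y _ => ?_
    have h1 : HasFDerivAt (fun y => g (y + w p)) (fderiv ℝ g (y + w p)) y :=
      (hasFDerivAt_comp_add_right (w p)).2
        ((hg.differentiable (by simp)) _).hasFDerivAt
    exact (L p).hasFDerivAt.comp y h1

/-- Superpositions of translates are as smooth as the given map, with the same bounds on derivatives
up to a constant. The target spaces vary in the induction, since the derivative of such an integral
is one of the same kind, for the derivative of the map. -/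
theorem contDiff_integral_translate_nat (hw : Continuous w) (hwK : ∀ᵐ p ∂μ, ‖w p‖ ≤ K) (N : ℕ) :
    ∀ {G G' : Type} [NormedAddCommGroup G] [NormedSpace ℝ G] [NormedAddCommGroup G']
      [NormedSpace ℝ G'] {L : P → G →L[ℝ] G'}, Continuous L → (∀ᵐ p ∂μ, ‖L p‖ ≤ K) →
      ∀ {g : E → G}, ContDiff ℝ ∞ g → ContDiff ℝ N (fun x => ∫ p, L p (g (x + w p)) ∂μ) ∧
        ∀ B : ℝ, (∀ x, ‖iteratedFDeriv ℝ N g x‖ ≤ B) →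
          ∀ x, ‖iteratedFDeriv ℝ N (fun x => ∫ p, L p (g (x + w p)) ∂μ) x‖
            ≤ K * μ.real Set.univ * B := by
  induction N with
  | zero =>
    intro G G' _ _ _ _ L hL hLK g hg
    constructor
    · have : Differentiable ℝ (fun x => ∫ p, L p (g (x + w p)) ∂μ) := fun x =>
        (hasFDerivAt_integral_translate hw hwK hL hLK (hg.of_le (by simp)) x).differentiableAt
      exact contDiff_zero.2 this.continuous
    · intro B hB x
      simp only [norm_iteratedFDeriv_zero] at hB ⊢
      have : ‖∫ p, L p (g (x + w p)) ∂μ‖ ≤ K * B * μ.real Set.univ := by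
        refine norm_integral_le_of_norm_le_const ?_
        filter_upwards [hLK] with p hp
        exact ((L p).le_opNorm _).trans
          (mul_le_mul hp (hB _) (norm_nonneg _) ((norm_nonneg _).trans hp))
      linarith
  | succ N ih =>
    intro G G' _ _ _ _ L hL hLK g hg
    have hd := fun x => hasFDerivAt_integral_translate hw hwK hL hLK (hg.of_le (by simp)) x
    have hfd : fderiv ℝ (fun x => ∫ p, L p (g (x + w p)) ∂μ) = fun x =>
        ∫ p, ContinuousLinearMap.compL ℝ E G G' (L p) (fderiv ℝ g (x + w p)) ∂μ :=
      funext fun x => (hd x).fderiv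
    have hLK' : ∀ᵐ p ∂μ, ‖ContinuousLinearMap.compL ℝ E G G' (L p)‖ ≤ K := by
      filter_upwards [hLK] with p hp
      refine ContinuousLinearMap.opNorm_le_bound _ ((norm_nonneg _).trans hp) fun A => ?_
      exact (ContinuousLinearMap.opNorm_comp_le _ _).trans
        (mul_le_mul_of_nonneg_right hp (norm_nonneg _))
    obtain ⟨h1, h2⟩ := ih ((ContinuousLinearMap.compL ℝ E G G').continuous.comp hL) hLK'
      (contDiff_infty_iff_fderiv.1 hg).2
    refine ⟨?_, fun B hB x => ?_⟩
    · rw [Nat.cast_add, Nat.cast_one, contDiff_succ_iff_fderiv]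
      refine ⟨fun x => (hd x).differentiableAt, by simp, ?_⟩
      rw [hfd]
      exact h1
    · rw [← norm_iteratedFDeriv_fderiv, hfd]
      exact h2 B (fun y => by rw [norm_iteratedFDeriv_fderiv]; exact hB y) x

theorem contDiff_integral_translate {G G' : Type} [NormedAddCommGroup G] [NormedSpace ℝ G]
    [NormedAddCommGroup G'] [NormedSpace ℝ G'] {L : P → G →L[ℝ] G'} (hw : Continuous w)
    (hwK : ∀ᵐ p ∂μ, ‖w p‖ ≤ K) (hL : Continuous L) (hLK : ∀ᵐ p ∂μ, ‖L p‖ ≤ K)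
    {g : E → G} (hg : ContDiff ℝ ∞ g) : ContDiff ℝ ∞ (fun x => ∫ p, L p (g (x + w p)) ∂μ) :=
  contDiff_infty.2 fun N => (contDiff_integral_translate_nat hw hwK N hL hLK hg).1

end Superposition

/-! ### Averaging over a period lattice -/

open scoped Pointwise in
/-- The normalized Haar measure of a fundamental domain: a probability measure with bounded support
whose convolution with any periodic map is constant. -/
theorem exists_periodAverage {E : Type} [NormedAddCommGroup E] [NormedSpace ℝ E]
    [FiniteDimensional ℝ E] [MeasurableSpace E] [BorelSpace E] (Λ : Submodule ℤ E)
    [DiscreteTopology Λ] [IsZLattice ℝ Λ] :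
    ∃ (ν : Measure E) (K : ℝ), IsProbabilityMeasure ν ∧ (∀ᵐ a ∂ν, ‖a‖ ≤ K) ∧
      ∀ (G : Type) [NormedAddCommGroup G] [NormedSpace ℝ G] (g : E → G),
        (∀ l ∈ Λ, ∀ x, g (x + l) = g x) → ∀ x, ∫ a, g (x + a) ∂ν = ∫ a, g a ∂ν := by
  let b := Module.Free.chooseBasis ℤ Λ
  let F := ZSpan.fundamentalDomain (b.ofZLatticeBasis ℝ Λ)
  let μ : Measure E := Measure.addHaar
  have hF : IsAddFundamentalDomain Λ F μ := ZLattice.isAddFundamentalDomain b μ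
  have hbd : Bornology.IsBounded F := ZSpan.fundamentalDomain_isBounded _
  have hm : MeasurableSet F := ZSpan.fundamentalDomain_measurableSet _
  have h0 : μ F ≠ 0 := ZSpan.measure_fundamentalDomain_ne_zero _
  have hfin : μ F ≠ ⊤ := hbd.measure_lt_top.ne
  obtain ⟨K, hK⟩ := hbd.exists_norm_le
  refine ⟨(μ F)⁻¹ • μ.restrict F, K, ⟨?_⟩, ?_, ?_⟩
  · simp [ENNReal.inv_mul_cancel h0 hfin]
  · exact Measure.ae_smul_measure ((ae_restrict_iff' hm).2 (Eventually.of_forall hK)) _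
  · intro G _ _ g hg x
    rw [integral_smul_measure, integral_smul_measure]
    congr 1
    have : VAddInvariantMeasure Λ E μ :=
      ⟨fun c s _ => measure_preimage_add μ (c : E) s⟩
    have hF' : IsAddFundamentalDomain Λ (x +ᵥ F) μ := hF.vadd_of_comm x
    have hinv : ∀ (l : Λ) (y : E), g (l +ᵥ y) = g y := by
      intro l y
      rw [Submodule.vadd_def, vadd_eq_add, add_comm]
      exact hg l l.2 y
    rw [hF.setIntegral_eq hF' hinv]
    have := (measurePreserving_add_left μ x).setIntegral_image_emb
      (measurableEmbedding_addLeft x) g F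
    rw [← this]
    rfl

/-! ### The averaging homotopy and exactness of closed currents -/

section Homotopy

variable {n : ℕ} {Λ : Submodule ℤ (Cn n)} {k : ℕ}

/-- The form on the torus whose pullback to `ℂⁿ` is a given smooth periodic form. -/
def ofPeriodic (g : Cn n → Cn n [⋀^Fin k]→L[ℝ] ℂ) (hg : ContDiff ℝ ∞ g)
    (hper : ∀ l ∈ Λ, ∀ x, g (x + l) = g x) : smoothForms Λ k :=
  ⟨fun p => g (Quotient.out p), by
    change ContDiff ℝ ∞ (fun x => g (Quotient.out (proj Λ x)))
    convert! hg using 2 with x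
    have h : proj Λ (Quotient.out (proj Λ x)) = proj Λ x := Quotient.out_eq _
    have h' : Quotient.out (proj Λ x) - x ∈ Λ := by
      rwa [proj, proj, Submodule.Quotient.eq] at h
    have := hper _ h' x
    rwa [add_sub_cancel] at this⟩

theorem lift_ofPeriodic (g : Cn n → Cn n [⋀^Fin k]→L[ℝ] ℂ) (hg : ContDiff ℝ ∞ g)
    (hper : ∀ l ∈ Λ, ∀ x, g (x + l) = g x) : lift (ofPeriodic g hg hper) = g := by
  funext x
  have h : proj Λ (Quotient.out (proj Λ x)) = proj Λ x := Quotient.out_eq _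
  have h' : Quotient.out (proj Λ x) - x ∈ Λ := by
    rwa [proj, proj, Submodule.Quotient.eq] at h
  have := hper _ h' x
  rwa [add_sub_cancel] at this

theorem lift_injective : Function.Injective (lift (Λ := Λ) (k := k)) := by
  intro φ ψ h
  ext1
  funext p
  obtain ⟨x, rfl⟩ := Submodule.Quotient.mk_surjective Λ p
  exact congrFun h x

theorem lift_add_mem (φ : smoothForms Λ k) {l : Cn n} (hl : l ∈ Λ) (x : Cn n) :
    lift φ (x + l) = lift φ x := by
  rw [lift, lift, proj_add_mem hl]

theorem lift_d (φ : smoothForms Λ k) : lift (d φ) = _root_.extDeriv (lift φ) :=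
  funext (extDerivFun_proj φ)

theorem lift_add (φ ψ : smoothForms Λ k) (x : Cn n) : lift (φ + ψ) x = lift φ x + lift ψ x := rfl

theorem lift_smul (c : ℂ) (φ : smoothForms Λ k) (x : Cn n) : lift (c • φ) x = c • lift φ x := rfl

variable (Λ) in
/-- The translation invariant form with a given value. -/
def constForm (c : Cn n [⋀^Fin k]→L[ℝ] ℂ) : smoothForms Λ k :=
  ofPeriodic (fun _ => c) contDiff_const (fun _ _ _ => rfl)

theorem constForm_apply (c : Cn n [⋀^Fin k]→L[ℝ] ℂ) (p : Torus Λ) : (constForm Λ c).1 p = c := rfl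

/-- The contraction `φ ↦ ι_a φ` of forms with a vector `a`. -/
def contraction (a : Cn n) : (Cn n [⋀^Fin (k + 1)]→L[ℝ] ℂ) →L[ℝ] Cn n [⋀^Fin k]→L[ℝ] ℂ :=
  (ContinuousAlternatingMap.curryLeftLI (𝕜 := ℝ) (E := Cn n) (F := ℂ)
    (n := k)).toContinuousLinearMap.flip a

theorem contraction_apply (a : Cn n) (f : Cn n [⋀^Fin (k + 1)]→L[ℝ] ℂ) :
    contraction a f = f.curryLeft a := rfl

theorem continuous_contraction : Continuous (contraction (n := n) (k := k)) :=
  ((ContinuousAlternatingMap.curryLeftLI (𝕜 := ℝ) (E := Cn n) (F := ℂ)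
    (n := k)).toContinuousLinearMap.flip).continuous

theorem norm_contraction_le (a : Cn n) : ‖contraction (k := k) a‖ ≤ ‖a‖ := by
  refine ContinuousLinearMap.opNorm_le_bound _ (norm_nonneg _) fun f => ?_
  rw [contraction_apply, mul_comm, ← f.norm_curryLeft]
  exact ContinuousLinearMap.le_opNorm _ _

/-- Cartan's formula for the Lie derivative in a constant direction. -/
theorem cartan_formula {φ : Cn n → Cn n [⋀^Fin (k + 1)]→L[ℝ] ℂ} (x a : Cn n) :
    ContinuousAlternatingMap.alternatizeUncurryFin
        (ContinuousLinearMap.compL ℝ _ _ _ (contraction a) (fderiv ℝ φ x)) +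
      contraction a (_root_.extDeriv φ x) = fderiv ℝ φ x a := by
  ext v
  rw [ContinuousAlternatingMap.add_apply, contraction_apply,
    ContinuousAlternatingMap.curryLeft_apply_apply, _root_.extDeriv,
    ContinuousAlternatingMap.alternatizeUncurryFin_apply,
    ContinuousAlternatingMap.alternatizeUncurryFin_apply, Fin.sum_univ_succ (n := k + 1)]
  have h : ∀ i : Fin (k + 1), (i.succ.removeNth (Matrix.vecCons a v) : Fin (k + 1) → Cn n) =
      Matrix.vecCons a (i.removeNth v) := by
    intro i
    funext j
    refine Fin.cases ?_ (fun j => ?_) j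
    · simp [Fin.removeNth]
    · simp [Fin.removeNth]
  have h0 : (Fin.removeNth 0 (Matrix.vecCons a v) : Fin (k + 1) → Cn n) = v := by
    funext j
    simp [Fin.removeNth]
  simp only [h, h0, Matrix.cons_val_zero, Matrix.cons_val_succ, Fin.val_succ, pow_succ,
    ContinuousLinearMap.compL_apply, ContinuousLinearMap.comp_apply, contraction_apply,
    ContinuousAlternatingMap.curryLeft_apply_apply, Fin.val_zero, pow_zero, one_smul, mul_neg,
    mul_one, neg_smul, Finset.sum_neg_distrib]
  abel

/-- The law of a pair `(a, s)`, with `a` distributed according to `ν` and `s` uniform in `[0, 1]`;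
the homotopy operator integrates over it along the segments `s ↦ s • a`. -/
def segmentLaw (ν : Measure (Cn n)) : Measure (Cn n × ℝ) :=
  ν.prod (volume.restrict (Set.Icc 0 1))

variable {ν : Measure (Cn n)} {K : ℝ}

instance [IsProbabilityMeasure ν] : IsProbabilityMeasure (segmentLaw ν) := by
  have : IsProbabilityMeasure ((volume : Measure ℝ).restrict (Set.Icc 0 1)) := ⟨by simp⟩
  unfold segmentLaw
  infer_instance

theorem ae_segmentLaw (hK : ∀ᵐ a ∂ν, ‖a‖ ≤ K) :
    ∀ᵐ p ∂(segmentLaw ν), p ∈ closedBall (0 : Cn n) K ×ˢ Set.Icc (0 : ℝ) 1 := by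
  have h1 : ∀ᵐ p ∂(segmentLaw ν), ‖p.1‖ ≤ K := Measure.quasiMeasurePreserving_fst.ae hK
  have h2 : ∀ᵐ p ∂(segmentLaw ν), p.2 ∈ Set.Icc (0 : ℝ) 1 :=
    Measure.quasiMeasurePreserving_snd.ae (ae_restrict_mem measurableSet_Icc)
  filter_upwards [h1, h2] with p hp hp'
  exact ⟨by simpa using hp, hp'⟩

theorem ae_norm_contraction_le (hK : ∀ᵐ a ∂ν, ‖a‖ ≤ K) :
    ∀ᵐ p ∂(segmentLaw ν), ‖contraction (k := k) p.1‖ ≤ K := by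
  filter_upwards [ae_segmentLaw hK] with p hp
  exact (norm_contraction_le _).trans (by simpa using hp.1)

theorem ae_norm_segment_le (hK : ∀ᵐ a ∂ν, ‖a‖ ≤ K) :
    ∀ᵐ p ∂(segmentLaw ν), ‖p.2 • p.1‖ ≤ K := by
  filter_upwards [ae_segmentLaw hK] with p hp
  have h1 : ‖p.1‖ ≤ K := by simpa using hp.1
  rw [norm_smul, Real.norm_of_nonneg hp.2.1]
  exact (mul_le_of_le_one_left (norm_nonneg _) hp.2.2).trans h1

theorem continuous_contraction_fst :
    Continuous (fun p : Cn n × ℝ => contraction (k := k) p.1) :=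
  continuous_contraction.comp continuous_fst

theorem continuous_segment : Continuous (fun p : Cn n × ℝ => p.2 • p.1) :=
  continuous_snd.smul continuous_fst

variable [IsProbabilityMeasure ν]

theorem integrable_segmentLaw {G : Type} [NormedAddCommGroup G] (hK : ∀ᵐ a ∂ν, ‖a‖ ≤ K)
    {h : Cn n × ℝ → G} (hh : Continuous h) : Integrable h (segmentLaw ν) := by
  obtain ⟨C, hC⟩ := ((isCompact_closedBall (0 : Cn n) K).prod
    (isCompact_Icc (a := (0 : ℝ)) (b := 1))).exists_bound_of_continuousOn hh.continuousOn
  exact Integrable.of_bound hh.aestronglyMeasurable C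
    ((ae_segmentLaw hK).mono fun p hp => hC p hp)

theorem continuous_contraction_lift (φ : smoothForms Λ (k + 1)) (x : Cn n) :
    Continuous (fun p : Cn n × ℝ => contraction p.1 (lift φ (x + p.2 • p.1))) :=
  continuous_contraction_fst.clm_apply
    ((contDiff_lift φ).continuous.comp (continuous_const.add continuous_segment))

/-- The homotopy operator `H`: the form `φ` is contracted with `a` and integrated along the segments
`[0, a]`, then averaged over `a`. -/
def homotopyForm (hK : ∀ᵐ a ∂ν, ‖a‖ ≤ K) (φ : smoothForms Λ (k + 1)) : smoothForms Λ k :=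
  ofPeriodic (fun x => ∫ p, contraction p.1 (lift φ (x + p.2 • p.1)) ∂(segmentLaw ν))
    (contDiff_integral_translate continuous_segment (ae_norm_segment_le hK)
      continuous_contraction_fst (ae_norm_contraction_le hK) (contDiff_lift φ))
    (fun l hl x => by simp only [add_right_comm x l, lift_add_mem φ hl])

theorem lift_homotopyForm (hK : ∀ᵐ a ∂ν, ‖a‖ ≤ K) (φ : smoothForms Λ (k + 1)) :
    lift (homotopyForm hK φ) =
      fun x => ∫ p, contraction p.1 (lift φ (x + p.2 • p.1)) ∂(segmentLaw ν) :=
  lift_ofPeriodic _ _ _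

/-- The homotopy operator as a linear map. -/
def homotopyOp (hK : ∀ᵐ a ∂ν, ‖a‖ ≤ K) : smoothForms Λ (k + 1) →ₗ[ℂ] smoothForms Λ k where
  toFun := homotopyForm hK
  map_add' φ ψ := by
    apply lift_injective
    funext x
    simp only [lift_add, lift_homotopyForm, map_add]
    exact integral_add (integrable_segmentLaw hK (continuous_contraction_lift φ x))
      (integrable_segmentLaw hK (continuous_contraction_lift ψ x))
  map_smul' c φ := by
    apply lift_injective
    funext x
    simp only [lift_smul, lift_homotopyForm, RingHom.id_apply]
    exact integral_smul c (fun p : Cn n × ℝ => contraction p.1 (lift φ (x + p.2 • p.1)))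

theorem lift_homotopyOp (hK : ∀ᵐ a ∂ν, ‖a‖ ≤ K) (φ : smoothForms Λ (k + 1)) :
    lift (homotopyOp hK φ) =
      fun x => ∫ p, contraction p.1 (lift φ (x + p.2 • p.1)) ∂(segmentLaw ν) :=
  lift_homotopyForm hK φ

/-- The homotopy formula: the mean of the translates of `φ` differs from `φ` by
`d (H φ) + H (d φ)`. -/
theorem homotopy_formula (hK : ∀ᵐ a ∂ν, ‖a‖ ≤ K) (φ : smoothForms Λ (k + 1)) (x : Cn n) :
    ∫ a, lift φ (x + a) ∂ν - lift φ x =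
      lift (d (homotopyOp hK φ)) x + lift (homotopyOp hK (d φ)) x := by
  have hφ1 : ContDiff ℝ 1 (lift φ) := (contDiff_lift φ).of_le (by simp)
  have hφ' : Continuous (fderiv ℝ (lift φ)) := hφ1.continuous_fderiv (by simp)
  have hseg : Continuous (fun p : Cn n × ℝ => x + p.2 • p.1) :=
    continuous_const.add continuous_segment
  have hcont : Continuous (fun p : Cn n × ℝ => ContinuousLinearMap.compL ℝ _ _ _
      (contraction (k := k) p.1) (fderiv ℝ (lift φ) (x + p.2 • p.1))) :=
    ((ContinuousLinearMap.compL ℝ (Cn n) _ _).continuous.comp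
      continuous_contraction_fst).clm_apply (hφ'.comp hseg)
  have hderiv : Continuous (fun p : Cn n × ℝ => fderiv ℝ (lift φ) (x + p.2 • p.1) p.1) :=
    (hφ'.comp hseg).clm_apply continuous_fst
  rw [lift_d, lift_homotopyOp, lift_homotopyOp, _root_.extDeriv,
    (hasFDerivAt_integral_translate continuous_segment (ae_norm_segment_le hK)
      continuous_contraction_fst (ae_norm_contraction_le hK) hφ1 x).fderiv]
  have hcomm := ContinuousLinearMap.integral_comp_comm (𝕜 := ℝ)
    (E := Cn n →L[ℝ] Cn n [⋀^Fin k]→L[ℝ] ℂ) (Fₗ := Cn n [⋀^Fin (k + 1)]→L[ℝ] ℂ)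
    (ContinuousAlternatingMap.alternatizeUncurryFinCLM (n := k) ℝ (Cn n) ℂ)
    (integrable_segmentLaw hK hcont)
  simp only [ContinuousAlternatingMap.alternatizeUncurryFinCLM_apply] at hcomm
  have hcont2 := (ContinuousAlternatingMap.alternatizeUncurryFinCLM (n := k) ℝ (Cn n)
    ℂ).continuous.comp hcont
  rw [Function.comp_def] at hcont2
  simp only [ContinuousAlternatingMap.alternatizeUncurryFinCLM_apply] at hcont2
  erw [← hcomm]
  rw [← integral_add (integrable_segmentLaw hK hcont2)
    (integrable_segmentLaw hK (continuous_contraction_lift (d φ) x))]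
  simp only [lift_d, cartan_formula]
  rw [segmentLaw, integral_prod _ (integrable_segmentLaw hK hderiv)]
  have hftc : ∀ a : Cn n, ∫ s in Set.Icc (0 : ℝ) 1, fderiv ℝ (lift φ) (x + s • a) a =
      lift φ (x + a) - lift φ x := by
    intro a
    rw [integral_Icc_eq_integral_Ioc, ← intervalIntegral.integral_of_le zero_le_one,
      intervalIntegral.integral_eq_sub_of_hasDerivAt (f := fun s : ℝ => lift φ (x + s • a))]
    · simp
    · intro s _
      have h1 : HasDerivAt (fun s : ℝ => x + s • a) a s := by
        simpa using ((hasDerivAt_id s).smul_const a).const_add x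
      exact ((hφ1.differentiable (by simp)) _).hasFDerivAt.comp_hasDerivAt s h1
    · refine Continuous.intervalIntegrable ?_ _ _
      exact (hφ'.comp (continuous_const.add (continuous_id.smul continuous_const))).clm_apply
        continuous_const
  simp only [hftc]
  have hint : Integrable (fun a => lift φ (x + a)) ν := by
    obtain ⟨C, hC⟩ := (isCompact_closedBall (0 : Cn n) K).exists_bound_of_continuousOn
      (hφ1.continuous.comp (continuous_const_add x)).continuousOn
    exact Integrable.of_bound (hφ1.continuous.comp (continuous_const_add x)).aestronglyMeasurable C
      (hK.mono fun a ha => hC a (by simpa using ha))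
  rw [integral_sub hint (integrable_const _), integral_const]
  simp

/-- A closed current that vanishes on translation invariant forms is exact: by the homotopy formula
it is `-U ∘ H ∘ d`. -/
theorem isExactCurrent_of_constForm [DiscreteTopology Λ] [IsZLattice ℝ Λ]
    {U : currents Λ (k + 1)} (hU : IsClosedCurrent U)
    (h0 : ∀ c : Cn n [⋀^Fin (k + 1)]→L[ℝ] ℂ, U.1 (constForm Λ c) = 0) : IsExactCurrent U := by
  obtain ⟨ν, K, hν, hK, hper⟩ := exists_periodAverage Λ
  obtain ⟨N, C, hNC⟩ := U.2
  refine ⟨⟨-(U.1 ∘ₗ homotopyOp hK), N, C * K, fun φ B hB => ?_⟩, fun φ => ?_⟩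
  · rw [LinearMap.neg_apply, norm_neg, LinearMap.comp_apply, mul_assoc]
    refine hNC _ _ fun m hm x => ?_
    rw [lift_homotopyOp]
    have := (contDiff_integral_translate_nat continuous_segment (ae_norm_segment_le hK) m
      continuous_contraction_fst (ae_norm_contraction_le hK)
      (contDiff_lift φ)).2 B (hB m hm) x
    simpa using this
  · have hφ : constForm Λ (∫ a, lift φ a ∂ν) =
        φ + d (homotopyOp hK φ) + homotopyOp hK (d φ) := by
      apply lift_injective
      funext x
      rw [lift_add, lift_add, add_assoc, ← homotopy_formula hK φ x, add_sub_cancel,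
        hper _ (lift φ) (fun l hl y => lift_add_mem φ hl y) x]
      rfl
    have := h0 (∫ a, lift φ a ∂ν)
    rw [hφ, map_add, map_add, hU, add_zero] at this
    exact eq_neg_of_add_eq_zero_left this

end Homotopy

/-! ### Local lifts of maps to the torus -/

section Lifts

variable {n : ℕ} {Λ : Submodule ℤ (Cn n)}

theorem proj_eq_proj_iff {x y : Cn n} : proj Λ x = proj Λ y ↔ x - y ∈ Λ :=
  Submodule.Quotient.eq Λ

variable [DiscreteTopology Λ]

/-- Two continuous local lifts of the same map differ by a constant. -/
theorem eventually_sub_eq_of_lifts {F : ℂ → Torus Λ} {s : Set ℂ} {z : ℂ} (hz : z ∈ s)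
    {f g : ℂ → Cn n} (hf : ContinuousWithinAt f s z) (hg : ContinuousWithinAt g s z)
    (hFf : ∀ᶠ w in 𝓝[s] z, F w = proj Λ (f w)) (hFg : ∀ᶠ w in 𝓝[s] z, F w = proj Λ (g w)) :
    ∀ᶠ w in 𝓝[s] z, f w - g w = f z - g z := by
  obtain ⟨ε, hε, hΛ⟩ := Metric.isOpen_singleton_iff.1 (isOpen_discrete {(0 : Λ)})
  have hsub : ContinuousWithinAt (fun w => f w - g w) s z := hf.sub hg
  have hclose := (Metric.tendsto_nhds.1 hsub) ε hε
  have hmem : ∀ᶠ w in 𝓝[s] z, f w - g w ∈ Λ := by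
    filter_upwards [hFf, hFg] with w h1 h2
    rw [← proj_eq_proj_iff, ← h1, ← h2]
  have hmemz : f z - g z ∈ Λ := hmem.self_of_nhdsWithin hz
  filter_upwards [hclose, hmem] with w h1 h2
  have h3 := hΛ ⟨(f w - g w) - (f z - g z), Λ.sub_mem h2 hmemz⟩ (by
    rw [Subtype.dist_eq, dist_eq_norm]
    simpa [dist_eq_norm] using h1)
  have h4 := congrArg Subtype.val h3
  exact sub_eq_zero.1 h4

theorem HasFDerivWithin.unique {F : ℂ → Torus Λ} {s : Set ℂ} {z : ℂ} (hz : z ∈ s)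
    (hs : UniqueDiffWithinAt ℝ s z) {L L' : ℂ →L[ℝ] Cn n} (h : HasFDerivWithin F L s z)
    (h' : HasFDerivWithin F L' s z) : L = L' := by
  obtain ⟨f, hf, hFf⟩ := h
  obtain ⟨g, hg, hFg⟩ := h'
  have h1 := eventually_sub_eq_of_lifts hz hf.continuousWithinAt hg.continuousWithinAt hFf hFg
  have h2 : HasFDerivWithinAt f L' s z := by
    refine (hg.add_const (f z - g z)).congr_of_eventuallyEq ?_ (by abel)
    filter_upwards [h1] with w hw
    rw [← hw]
    abel
  exact hs.eq hf h2

theorem fderivTorus_eq {F : ℂ → Torus Λ} {s : Set ℂ} {z : ℂ} (hz : z ∈ s)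
    (hs : UniqueDiffWithinAt ℝ s z) {L : ℂ →L[ℝ] Cn n} (h : HasFDerivWithin F L s z) :
    fderivTorus F s z = L := by
  have h' : ∃ L, HasFDerivWithin F L s z := ⟨L, h⟩
  rw [fderivTorus, dif_pos h']
  exact h'.choose_spec.unique hz hs h

end Lifts

/-! ### Regularity of holomorphic discs -/

namespace HolDisc

variable {n : ℕ} {Λ : Submodule ℤ (Cn n)} (D : HolDisc Λ)

theorem uniqueDiffOn : UniqueDiffOn ℝ (closedBall D.center D.radius) :=
  uniqueDiffOn_convex (convex_closedBall _ _) (by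
    rw [interior_closedBall _ D.radius_pos.ne']
    exact nonempty_ball.2 D.radius_pos)

variable [DiscreteTopology Λ]

theorem exists_lift_within {z : ℂ} (hz : z ∈ closedBall D.center D.radius) :
    ∃ f : ℂ → Cn n, ContDiffWithinAt ℝ ∞ f (closedBall D.center D.radius) z ∧
      ∀ᶠ w in 𝓝[closedBall D.center D.radius] z, D.toFun w = proj Λ (f w) ∧
        DifferentiableWithinAt ℝ f (closedBall D.center D.radius) w ∧
        D.deriv w = fderivWithin ℝ f (closedBall D.center D.radius) w := by
  obtain ⟨f, hf, hF⟩ := D.smooth z hz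
  refine ⟨f, hf, ?_⟩
  have h1 : ∀ᶠ w in 𝓝[closedBall D.center D.radius] z,
      ContDiffWithinAt ℝ 1 f (closedBall D.center D.radius) w := by
    have := (hf.of_le (m := 1) (by simp)).eventually (by simp)
    rwa [Set.insert_eq_of_mem hz] at this
  filter_upwards [hF, eventually_eventually_nhdsWithin.2 hF, h1, self_mem_nhdsWithin]
    with w hw hw' hfw hws
  have hd : DifferentiableWithinAt ℝ f (closedBall D.center D.radius) w :=
    hfw.differentiableWithinAt (by simp)
  exact ⟨hw, hd, fderivTorus_eq hws (D.uniqueDiffOn w hws) ⟨f, hd.hasFDerivWithinAt, hw'⟩⟩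

theorem exists_lift {z : ℂ} (hz : z ∈ ball D.center D.radius) :
    ∃ f : ℂ → Cn n, ∀ᶠ w in 𝓝 z, DifferentiableAt ℂ f w ∧ D.toFun w = proj Λ (f w) ∧
      D.deriv w = fderiv ℝ f w := by
  obtain ⟨f, hf, hF⟩ := D.holomorphic z hz
  refine ⟨f, ?_⟩
  filter_upwards [hf, hF, eventually_eventually_nhds.2 hF, isOpen_ball.mem_nhds hz]
    with w hfw hw hw' hwb
  have hws := ball_subset_closedBall hwb
  refine ⟨hfw, hw, fderivTorus_eq hws (D.uniqueDiffOn w hws) ⟨f, ?_, ?_⟩⟩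
  · exact (hfw.restrictScalars ℝ).hasFDerivAt.hasFDerivWithinAt
  · exact hw'.filter_mono nhdsWithin_le_nhds

theorem continuousOn_deriv : ContinuousOn D.deriv (closedBall D.center D.radius) := by
  intro z hz
  obtain ⟨f, hf, h⟩ := D.exists_lift_within hz
  have h1 : ContinuousWithinAt (fderivWithin ℝ f (closedBall D.center D.radius))
      (closedBall D.center D.radius) z :=
    (hf.fderivWithin_right (m := 0) D.uniqueDiffOn (by simp) hz).continuousWithinAt
  exact h1.congr_of_eventuallyEq (h.mono fun w hw => hw.2.2) (h.self_of_nhdsWithin hz).2.2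

theorem continuousOn_form {k : ℕ} (φ : smoothForms Λ k) :
    ContinuousOn (fun z => φ.1 (D.toFun z)) (closedBall D.center D.radius) := by
  intro z hz
  obtain ⟨f, hf, h⟩ := D.exists_lift_within hz
  have h1 : ContinuousWithinAt (fun w => lift φ (f w)) (closedBall D.center D.radius) z :=
    (contDiff_lift φ).continuous.continuousAt.comp_continuousWithinAt hf.continuousWithinAt
  refine h1.congr_of_eventuallyEq (h.mono fun w hw => ?_) ?_
  · simp only [hw.1, lift]
  · simp only [(h.self_of_nhdsWithin hz).1, lift]

theorem continuousOn_pullback (φ : smoothForms Λ 2) :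
    ContinuousOn (fun z => D.pullback φ z ![1, Complex.I]) (closedBall D.center D.radius) := by
  have h1 : ContinuousOn (fun z => fun i : Fin 2 => D.deriv z (![1, Complex.I] i))
      (closedBall D.center D.radius) :=
    continuousOn_pi.2 fun i => D.continuousOn_deriv.clm_apply continuousOn_const
  exact (D.continuousOn_form φ).eval h1

/-- Inside the disc the differential is complex linear. -/
theorem deriv_I {z : ℂ} (hz : z ∈ ball D.center D.radius) :
    D.deriv z Complex.I = Complex.I • D.deriv z 1 := by
  obtain ⟨f, h⟩ := D.exists_lift hz
  obtain ⟨h1, -, h2⟩ := h.self_of_nhds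
  rw [h2, h1.fderiv_restrictScalars ℝ]
  simp

/-- The value of `F^*φ` on `(1, i)`. -/
theorem pullback_apply {z : ℂ} (hz : z ∈ ball D.center D.radius) (φ : smoothForms Λ 2) :
    D.pullback φ z ![1, Complex.I] =
      φ.1 (D.toFun z) ![D.deriv z 1, Complex.I • D.deriv z 1] := by
  rw [← D.deriv_I hz]
  change φ.1 (D.toFun z) _ = _
  congr 1
  funext i
  fin_cases i <;> rfl

theorem norm_deriv_apply {z : ℂ} (hz : z ∈ ball D.center D.radius) (h : ℂ) :
    ‖D.deriv z h‖ = ‖h‖ * ‖D.deriv z 1‖ := by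
  have : D.deriv z h = h • D.deriv z 1 := by
    conv_lhs => rw [show h = h.re • (1 : ℂ) + h.im • Complex.I by simp [Complex.re_add_im]]
    rw [map_add, map_smul, map_smul, D.deriv_I hz, ← Complex.coe_smul h.re, ← Complex.coe_smul h.im,
      smul_smul, ← add_smul, Complex.re_add_im]
  rw [this, norm_smul]

end HolDisc

/-! ### Green's theorem on a disc -/

section Green

theorem integral_ball_eq_polar (g : ℂ → ℂ) (c : ℂ) (t : ℝ) :
    ∫ z in ball c t, g z =
      ∫ p in Set.Icc ((0 : ℝ), -Real.pi) (t, Real.pi), p.1 • g (circleMap c p.1 p.2) := by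
  have hset : Set.Icc ((0 : ℝ), -Real.pi) (t, Real.pi) =ᵐ[volume]
      Set.Ioo 0 t ×ˢ Set.Ioo (-Real.pi) Real.pi := by
    rw [← Set.Icc_prod_Icc]
    exact Measure.set_prod_ae_eq Ioo_ae_eq_Icc.symm Ioo_ae_eq_Icc.symm
  rw [setIntegral_congr_set hset, ← integral_indicator measurableSet_ball,
    ← integral_add_left_eq_self _ c, ← Complex.integral_comp_polarCoord_symm]
  have hsub : Set.Ioo 0 t ×ˢ Set.Ioo (-Real.pi) Real.pi ⊆ polarCoord.target := fun p hp =>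
    ⟨hp.1.1, hp.2⟩
  symm
  rw [setIntegral_eq_of_subset_of_forall_sdiff_eq_zero polarCoord.open_target.measurableSet hsub]
  · refine setIntegral_congr_fun (measurableSet_Ioo.prod measurableSet_Ioo) fun p hp => ?_
    have h1 : c + Complex.polarCoord.symm p = circleMap c p.1 p.2 := by
      rw [circleMap, Complex.polarCoord_symm_apply, Complex.exp_mul_I]
      push_cast
      rfl
    have h2 : circleMap c p.1 p.2 ∈ ball c t := by
      rw [mem_ball, dist_eq_norm, circleMap_sub_center, norm_circleMap_zero, abs_of_pos hp.1.1]
      exact hp.1.2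
    simp only [h1, Set.indicator_of_mem h2]
  · intro p hp
    have h1 : c + Complex.polarCoord.symm p ∉ ball c t := by
      intro h
      rw [mem_ball, dist_eq_norm, add_sub_cancel_left, Complex.norm_polarCoord_symm,
        abs_of_pos hp.1.1] at h
      exact hp.2 ⟨⟨hp.1.1, h⟩, hp.1.2⟩
    rw [Set.indicator_of_notMem h1, smul_zero]

/-- An alternating real bilinear expression on `ℂ` is multiplied by `|e|²` when `(1, i)` is replaced
by `(e, e i)`. -/
theorem curl_mul (B : ℂ →L[ℝ] ℂ →L[ℝ] ℂ) (e : ℂ) :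
    B e (e * Complex.I) - B (e * Complex.I) e =
      ((‖e‖ ^ 2 : ℝ) : ℂ) * (B 1 Complex.I - B Complex.I 1) := by
  have h1 : e = e.re • (1 : ℂ) + e.im • Complex.I := by simp [Complex.re_add_im]
  have h2 : e * Complex.I = (-e.im) • (1 : ℂ) + e.re • Complex.I := by
    apply Complex.ext <;> simp
  rw [h2, Complex.sq_norm, Complex.normSq_apply]
  generalize e.re = a at *
  generalize e.im = b at *
  subst h1
  simp only [map_add, map_smul, add_apply, smul_apply]
  simp only [Complex.real_smul]
  push_cast
  ring

theorem hasFDerivAt_exp_snd (p : ℝ × ℝ) :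
    HasFDerivAt (fun p : ℝ × ℝ => Complex.exp (p.2 * Complex.I))
      ((ContinuousLinearMap.snd ℝ ℝ ℝ).smulRight
        (Complex.exp (p.2 * Complex.I) * Complex.I)) p := by
  have h3 : HasDerivAt (fun θ : ℝ => Complex.exp (θ * Complex.I))
      (Complex.exp (p.2 * Complex.I) * Complex.I) p.2 := by
    simpa using ((Complex.ofRealCLM.hasDerivAt (x := p.2)).mul_const Complex.I).cexp
  have h4 : HasFDerivAt (fun p : ℝ × ℝ => p.2) (ContinuousLinearMap.snd ℝ ℝ ℝ) p := hasFDerivAt_snd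
  refine (h3.hasFDerivAt.comp p h4).congr_fderiv ?_
  ext <;> simp

theorem hasFDerivAt_circleMap (c : ℂ) (p : ℝ × ℝ) :
    HasFDerivAt (fun p : ℝ × ℝ => circleMap c p.1 p.2)
      ((ContinuousLinearMap.fst ℝ ℝ ℝ).smulRight (Complex.exp (p.2 * Complex.I)) +
        (ContinuousLinearMap.snd ℝ ℝ ℝ).smulRight (circleMap 0 p.1 p.2 * Complex.I)) p := by
  have h1 : HasFDerivAt (fun p : ℝ × ℝ => (p.1 : ℂ))
      (Complex.ofRealCLM.comp (ContinuousLinearMap.fst ℝ ℝ ℝ)) p :=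
    Complex.ofRealCLM.hasFDerivAt.comp p hasFDerivAt_fst
  refine ((h1.mul (hasFDerivAt_exp_snd p)).const_add c).congr_fderiv ?_
  ext <;> simp [circleMap_zero, mul_assoc]

/-- Green's theorem on a disc, for a one-form `α` that is continuous up to the boundary and whose
curl extends continuously to the boundary. In polar coordinates it is the divergence theorem on a
rectangle. -/
theorem green_disc {α : ℂ → ℂ →L[ℝ] ℂ} {α' : ℂ → ℂ →L[ℝ] ℂ →L[ℝ] ℂ} {g : ℂ → ℂ} {c : ℂ} {t : ℝ}
    (ht : 0 < t) (hα : ContinuousOn α (closedBall c t))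
    (hα' : ∀ z ∈ ball c t, HasFDerivAt α (α' z) z) (hg : ContinuousOn g (closedBall c t))
    (hcurl : ∀ z ∈ ball c t, α' z 1 Complex.I - α' z Complex.I 1 = g z) :
    ∫ z in ball c t, g z =
      ∫ θ in (0 : ℝ)..(2 * Real.pi), α (circleMap c t θ) (circleMap 0 t θ * Complex.I) := by
  have hpi := Real.pi_pos
  set γ : ℝ × ℝ → ℂ := fun p => circleMap c p.1 p.2 with hγ
  have hγc : Continuous γ := by
    simp only [hγ, circleMap]
    fun_prop
  have hγ0 : Continuous (fun p : ℝ × ℝ => circleMap 0 p.1 p.2 * Complex.I) := by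
    simp only [circleMap]
    fun_prop
  have hec : Continuous (fun p : ℝ × ℝ => Complex.exp (p.2 * Complex.I)) := by fun_prop
  have hmaps : Set.MapsTo γ (Set.Icc ((0 : ℝ), -Real.pi) (t, Real.pi)) (closedBall c t) := by
    intro p hp
    rw [mem_closedBall, dist_eq_norm, hγ, circleMap_sub_center, norm_circleMap_zero,
      abs_of_nonneg hp.1.1]
    exact hp.2.1
  have hmaps' : ∀ p ∈ Set.Ioo 0 t ×ˢ Set.Ioo (-Real.pi) Real.pi, γ p ∈ ball c t := by
    intro p hp
    rw [mem_ball, dist_eq_norm, hγ, circleMap_sub_center, norm_circleMap_zero,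
      abs_of_pos hp.1.1]
    exact hp.1.2
  have hαγ : ContinuousOn (fun p => α (γ p)) (Set.Icc ((0 : ℝ), -Real.pi) (t, Real.pi)) :=
    hα.comp hγc.continuousOn hmaps
  set F : ℝ × ℝ → ℂ := fun p => α (γ p) (circleMap 0 p.1 p.2 * Complex.I) with hF
  set H : ℝ × ℝ → ℂ := fun p => -α (γ p) (Complex.exp (p.2 * Complex.I)) with hH
  have hderiv : ∀ p ∈ Set.Ioo 0 t ×ˢ Set.Ioo (-Real.pi) Real.pi, ∃ F' H' : ℝ × ℝ →L[ℝ] ℂ,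
      HasFDerivAt F F' p ∧ HasFDerivAt H H' p ∧ F' (1, 0) + H' (0, 1) = p.1 • g (γ p) := by
    intro p hp
    have h1 := (hα' (γ p) (hmaps' p hp)).comp p (hasFDerivAt_circleMap c p)
    have h2 := h1.clm_apply ((hasFDerivAt_circleMap 0 p).mul_const Complex.I)
    have h3 := (h1.clm_apply (hasFDerivAt_exp_snd p)).neg
    refine ⟨_, _, h2, h3, ?_⟩
    have hc := curl_mul (α' (γ p)) (Complex.exp (p.2 * Complex.I))
    rw [Complex.norm_exp_ofReal_mul_I, hcurl _ (hmaps' p hp)] at hc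
    have h4 : circleMap 0 p.1 p.2 * Complex.I =
        p.1 • (Complex.exp (p.2 * Complex.I) * Complex.I) := by
      rw [circleMap_zero, Complex.real_smul, mul_assoc]
    simp only [one_pow, Complex.ofReal_one, one_mul] at hc
    simp only [h4]
    simp [-Complex.real_smul]
    rw [← hc, smul_sub, mul_comm Complex.I]
    abel
  choose! F' H' hF' hH' hdiv using hderiv
  classical
  -- The divergence is only controlled in the interior; on the boundary it is given its limit value.
  set S : Set (ℝ × ℝ) := Set.Ioo 0 t ×ˢ Set.Ioo (-Real.pi) Real.pi with hS
  set F'' : ℝ × ℝ → ℝ × ℝ →L[ℝ] ℂ := fun p =>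
    if p ∈ S then F' p else (ContinuousLinearMap.fst ℝ ℝ ℝ).smulRight (p.1 • g (γ p)) with hF''
  set H'' : ℝ × ℝ → ℝ × ℝ →L[ℝ] ℂ := fun p => if p ∈ S then H' p else 0 with hH''
  have hsum : ∀ p, F'' p (1, 0) + H'' p (0, 1) = p.1 • g (γ p) := by
    intro p
    by_cases hp : p ∈ S
    · simp only [hF'', hH'', if_pos hp, hdiv p hp]
    · simp [hF'', hH'', if_neg hp]
  have key := integral_divergence_prod_Icc_of_hasFDerivAt_of_le F H F'' H''
    ((0 : ℝ), -Real.pi) (t, Real.pi) ⟨ht.le, by simp; linarith⟩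
    (hαγ.clm_apply hγ0.continuousOn) ((hαγ.clm_apply hec.continuousOn).neg)
    (fun p hp => by simpa only [hF'', if_pos (show p ∈ S from hp)] using hF' p hp)
    (fun p hp => by simpa only [hH'', if_pos (show p ∈ S from hp)] using hH' p hp)
    (by
      simp only [hsum]
      exact (continuous_fst.continuousOn.smul
        (hg.comp hγc.continuousOn hmaps)).integrableOn_compact isCompact_Icc)
  simp only [hsum] at key
  rw [integral_ball_eq_polar g c t, key]
  have hper : ∀ x : ℝ, H (x, Real.pi) = H (x, -Real.pi) := by
    intro x
    have : Complex.exp (((-Real.pi : ℝ) : ℂ) * Complex.I) =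
        Complex.exp ((Real.pi : ℂ) * Complex.I) := by
      rw [Complex.ofReal_neg, neg_mul, Complex.exp_neg, Complex.exp_pi_mul_I]
      norm_num
    simp only [hH, hγ, circleMap, this]
  have h0 : ∀ y : ℝ, F (0, y) = 0 := by
    intro y
    simp [hF]
  simp only [hper, h0, sub_self, zero_add, intervalIntegral.integral_zero, sub_zero]
  have hp : Function.Periodic (fun θ : ℝ => F (t, θ)) (2 * Real.pi) := by
    intro θ
    simp only [hF, hγ, periodic_circleMap c t θ, periodic_circleMap 0 t θ]
  have := hp.intervalIntegral_add_eq (-Real.pi) 0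
  rw [zero_add, show -Real.pi + 2 * Real.pi = Real.pi by ring] at this
  exact this

end Green

/-! ### Stokes' theorem, areas and lengths of holomorphic discs -/

/-- The identification of alternating forms of degree one with linear forms. -/
def oneFormCLM {E : Type} [NormedAddCommGroup E] [NormedSpace ℝ E] :
    (E [⋀^Fin 1]→L[ℝ] ℂ) →L[ℝ] E →L[ℝ] ℂ :=
  (ContinuousLinearMap.compL ℝ E (E [⋀^Fin 0]→L[ℝ] ℂ) ℂ
    (ContinuousAlternatingMap.apply ℝ E ℂ ![])).comp
    (ContinuousAlternatingMap.curryLeftLI (𝕜 := ℝ) (E := E) (F := ℂ)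
      (n := 0)).toContinuousLinearMap

theorem oneFormCLM_apply {E : Type} [NormedAddCommGroup E] [NormedSpace ℝ E]
    (η : E [⋀^Fin 1]→L[ℝ] ℂ) (h : E) : oneFormCLM η h = η ![h] := rfl

namespace HolDisc

variable {n : ℕ} {Λ : Submodule ℤ (Cn n)} (D : HolDisc Λ)

/-- The pullback of a one-form to the disc. -/
def pullbackOne (φ : smoothForms Λ 1) (z : ℂ) : ℂ [⋀^Fin 1]→L[ℝ] ℂ :=
  (φ.1 (D.toFun z)).compContinuousLinearMap (D.deriv z)

theorem pullbackOne_apply (φ : smoothForms Λ 1) (z h : ℂ) :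
    D.pullbackOne φ z ![h] = φ.1 (D.toFun z) ![D.deriv z h] := by
  change φ.1 (D.toFun z) _ = _
  congr 1
  funext i
  fin_cases i
  rfl

theorem circleMap_mem {t : ℝ} (ht : 0 ≤ t) (htR : t ≤ D.radius) (θ : ℝ) :
    circleMap D.center t θ ∈ closedBall D.center D.radius :=
  closedBall_subset_closedBall htR (circleMap_mem_closedBall _ ht _)

/-- The area of the image of a concentric disc, in terms of the differential. -/
def energy (t : ℝ) : ℝ := ∫ z in ball D.center t, ‖D.deriv z 1‖ ^ 2

theorem energy_nonneg (t : ℝ) : 0 ≤ D.energy t := integral_nonneg fun _ => by positivity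

theorem integrableOn_of_continuousOn {G : Type} [NormedAddCommGroup G] {g : ℂ → G}
    (hg : ContinuousOn g (closedBall D.center D.radius)) {t : ℝ} (htR : t ≤ D.radius) :
    IntegrableOn g (ball D.center t) :=
  (hg.integrableOn_compact (isCompact_closedBall _ _)).mono_set
    (ball_subset_closedBall.trans (closedBall_subset_closedBall htR))

variable [DiscreteTopology Λ]

theorem continuousOn_pullbackOne (φ : smoothForms Λ 1) :
    ContinuousOn (D.pullbackOne φ) (closedBall D.center D.radius) := fun z hz =>
  (ContinuousAlternatingMap.hasStrictFDerivAt_compContinuousLinearMap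
    (φ.1 (D.toFun z), D.deriv z)).continuousAt.comp_continuousWithinAt
    (f := fun x => (φ.1 (D.toFun x), D.deriv x))
    ((D.continuousOn_form φ z hz).prodMk (D.continuousOn_deriv z hz))

/-- At interior points the pullback is differentiable and commutes with `d`, because the disc has a
smooth local lift there. -/
theorem differentiableAt_pullbackOne (φ : smoothForms Λ 1) {z : ℂ}
    (hz : z ∈ ball D.center D.radius) : DifferentiableAt ℝ (D.pullbackOne φ) z ∧
      _root_.extDeriv (D.pullbackOne φ) z = D.pullback (d φ) z := by
  obtain ⟨f, h⟩ := D.exists_lift hz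
  have hω : ContDiffAt ℝ ω f z := by
    have : AnalyticAt ℂ f z := Complex.analyticAt_iff_eventually_differentiableAt.2
      (h.mono fun w hw => hw.1)
    exact this.contDiffAt.restrict_scalars ℝ
  have heq : D.pullbackOne φ =ᶠ[𝓝 z]
      fun w => (lift φ (f w)).compContinuousLinearMap (fderiv ℝ f w) := by
    filter_upwards [h] with w hw
    rw [pullbackOne, hw.2.1, hw.2.2, lift]
  have hφ : DifferentiableAt ℝ (lift φ) (f z) := (contDiff_lift φ).differentiable (by simp) _
  have hf' : DifferentiableAt ℝ (fderiv ℝ f) z :=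
    (hω.fderiv_right (m := 1) (by simp)).differentiableAt (by simp)
  have hf : DifferentiableAt ℝ f z := hω.differentiableAt (by simp)
  constructor
  · exact ((hφ.comp z hf).continuousAlternatingMapCompContinuousLinearMap hf').congr_of_eventuallyEq
      heq
  · rw [heq.extDeriv_eq, extDeriv_pullback hφ hω (by simp), pullback, h.self_of_nhds.2.1,
      h.self_of_nhds.2.2]
    congr 1
    exact (congrFun (lift_d φ) (f z)).symm

/-- Stokes' theorem on the concentric discs. -/
theorem integral_d (φ : smoothForms Λ 1) {t : ℝ} (ht : 0 < t) (htR : t ≤ D.radius) :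
    D.integral t (d φ) = ∫ θ in (0 : ℝ)..(2 * Real.pi), φ.1 (D.toFun (circleMap D.center t θ))
      ![D.deriv (circleMap D.center t θ) (circleMap 0 t θ * Complex.I)] := by
  have hsub : closedBall D.center t ⊆ closedBall D.center D.radius := closedBall_subset_closedBall htR
  have hsub' : ball D.center t ⊆ ball D.center D.radius := ball_subset_ball htR
  have key := green_disc (α := fun z => oneFormCLM (D.pullbackOne φ z))
    (α' := fun z => oneFormCLM.comp (fderiv ℝ (D.pullbackOne φ) z))
    (g := fun z => D.pullback (d φ) z ![1, Complex.I]) ht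
    (oneFormCLM.continuous.comp_continuousOn ((D.continuousOn_pullbackOne φ).mono hsub))
    (fun z hz => oneFormCLM.hasFDerivAt.comp z
      (D.differentiableAt_pullbackOne φ (hsub' hz)).1.hasFDerivAt)
    ((D.continuousOn_pullback _).mono hsub)
    (fun z hz => by
      obtain ⟨h1, h2⟩ := D.differentiableAt_pullbackOne φ (hsub' hz)
      rw [← h2, _root_.extDeriv, ContinuousAlternatingMap.alternatizeUncurryFin_apply,
        Fin.sum_univ_two]
      have e0 : (Fin.removeNth 0 ![(1 : ℂ), Complex.I] : Fin 1 → ℂ) = ![Complex.I] := by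
        funext i; fin_cases i; rfl
      have e1 : (Fin.removeNth 1 ![(1 : ℂ), Complex.I] : Fin 1 → ℂ) = ![1] := by
        funext i; fin_cases i; rfl
      rw [e0, e1]
      simp [oneFormCLM_apply, sub_eq_add_neg])
  simp only [oneFormCLM_apply, pullbackOne_apply] at key
  exact key


theorem norm_integral_d_le (φ : smoothForms Λ 1) {B : ℝ} (hB : ∀ x, ‖lift φ x‖ ≤ B) {t : ℝ}
    (ht : 0 < t) (htR : t ≤ D.radius) : ‖D.integral t (d φ)‖ ≤ B * D.length t := by
  rw [D.integral_d φ ht htR, length, ← intervalIntegral.integral_const_mul]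
  refine intervalIntegral.norm_integral_le_of_norm_le (by positivity)
    (Eventually.of_forall fun θ _ => ?_) ?_
  · obtain ⟨x, hx⟩ := Submodule.Quotient.mk_surjective Λ (D.toFun (circleMap D.center t θ))
    have := (φ.1 (D.toFun (circleMap D.center t θ))).le_opNorm
      ![D.deriv (circleMap D.center t θ) (circleMap 0 t θ * Complex.I)]
    rw [Fin.prod_univ_one] at this
    refine this.trans (mul_le_mul_of_nonneg_right ?_ (norm_nonneg _))
    rw [← hx]
    exact hB x
  · refine Continuous.intervalIntegrable ?_ _ _
    have h1 : Continuous fun θ => D.deriv (circleMap D.center t θ) :=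
      D.continuousOn_deriv.comp_continuous (continuous_circleMap _ _)
        (D.circleMap_mem ht.le htR)
    exact continuous_const.mul
      (h1.clm_apply ((continuous_circleMap 0 t).mul continuous_const)).norm

theorem stdForm_apply_I (v : Cn n) :
    stdForm n ![v, Complex.I • v] = ((‖v‖ ^ 2 : ℝ) : ℂ) := by
  change Complex.I / 2 * ∑ j, (v j * star ((Complex.I • v) j) - (Complex.I • v) j * star (v j)) = _
  rw [EuclideanSpace.norm_sq_eq, Finset.mul_sum]
  push_cast
  refine Finset.sum_congr rfl fun j _ => ?_
  rw [← Complex.conj_mul', PiLp.smul_apply, smul_eq_mul, star_mul']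
  simp only [Complex.star_def, Complex.conj_I]
  linear_combination (-(v j * (starRingEnd ℂ) (v j))) * Complex.I_sq

theorem integral_omega {t : ℝ} (htR : t ≤ D.radius) :
    D.integral t (omega Λ) = (D.energy t : ℂ) := by
  rw [energy, ← integral_complex_ofReal, integral]
  refine setIntegral_congr_fun measurableSet_ball fun z hz => ?_
  simp only [D.pullback_apply (ball_subset_ball htR hz)]
  exact stdForm_apply_I _

theorem area_eq : D.area = D.energy D.radius := by
  rw [area, D.integral_omega le_rfl, Complex.ofReal_re]

theorem continuousOn_energyDensity :
    ContinuousOn (fun z => ‖D.deriv z 1‖ ^ 2) (closedBall D.center D.radius) :=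
  (D.continuousOn_deriv.clm_apply continuousOn_const).norm.pow 2

theorem norm_integral_le (φ : smoothForms Λ 2) {B : ℝ} (hB : ∀ x, ‖lift φ x‖ ≤ B) {t : ℝ}
    (htR : t ≤ D.radius) : ‖D.integral t φ‖ ≤ B * D.energy t := by
  rw [integral, energy, ← MeasureTheory.integral_const_mul]
  refine norm_integral_le_of_norm_le
    ((D.integrableOn_of_continuousOn D.continuousOn_energyDensity htR).const_mul B) ?_
  filter_upwards [ae_restrict_mem measurableSet_ball] with z hz
  obtain ⟨x, hx⟩ := Submodule.Quotient.mk_surjective Λ (D.toFun z)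
  rw [D.pullback_apply (ball_subset_ball htR hz)]
  refine ((φ.1 (D.toFun z)).le_opNorm _).trans ?_
  rw [Fin.prod_univ_two]
  simp only [Matrix.cons_val_zero, Matrix.cons_val_one, norm_smul, Complex.norm_I, one_mul]
  rw [← sq, ← hx]
  exact mul_le_mul_of_nonneg_right (hB x) (by positivity)

/-- A disc with vanishing differential would be constant. -/
theorem exists_deriv_ne_zero : ∃ z ∈ ball D.center D.radius, D.deriv z 1 ≠ 0 := by
  by_contra! h
  have h3 : Set.EqOn D.deriv 0 (ball D.center D.radius) := by
    intro z hz
    ext1 w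
    change D.deriv z w = 0
    rw [← norm_eq_zero, D.norm_deriv_apply hz, h z hz, norm_zero, mul_zero]
  have h5 : Set.EqOn D.deriv 0 (closedBall D.center D.radius) :=
    h3.of_subset_closure D.continuousOn_deriv continuousOn_const ball_subset_closedBall
      (closure_ball _ D.radius_pos.ne').ge
  obtain ⟨z, hz, w, hw, hne⟩ := D.nonconstant
  refine hne ((convex_closedBall D.center D.radius).isPreconnected.induction₂
    (fun x y => D.toFun x = D.toFun y) (fun x hx => ?_) (fun x y z _ _ _ => Eq.trans)
    (fun x y _ _ => Eq.symm) hz hw)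
  obtain ⟨f, -, hf⟩ := D.exists_lift_within hx
  obtain ⟨δ, hδ, hball⟩ := mem_nhdsWithin_iff.1 hf
  rw [eventually_iff, mem_nhdsWithin_iff]
  refine ⟨δ, hδ, fun y hy => ?_⟩
  have hxm : x ∈ ball x δ ∩ closedBall D.center D.radius := ⟨mem_ball_self hδ, hx⟩
  have := ((convex_ball x δ).inter
    (convex_closedBall D.center D.radius)).norm_image_sub_le_of_norm_hasFDerivWithin_le
    (f := f) (f' := fun _ => 0) (C := 0) (fun u hu => by
      have h6 := (hball hu).2.1.hasFDerivWithinAt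
      rw [← (hball hu).2.2, h5 hu.2] at h6
      exact h6.mono Set.inter_subset_right) (fun _ _ => by simp) hxm hy
  rw [zero_mul, norm_le_zero_iff, sub_eq_zero] at this
  change D.toFun x = D.toFun y
  rw [(hball hxm).1, (hball hy).1, this]

theorem energy_pos_of_deriv_ne_zero {z : ℂ} {t : ℝ} (htR : t ≤ D.radius)
    (hz : z ∈ ball D.center t) (hne : D.deriv z 1 ≠ 0) : 0 < D.energy t := by
  refine (D.energy_nonneg _).lt_of_ne fun h => hne ?_
  have h1 : (fun z => ‖D.deriv z 1‖ ^ 2) =ᵐ[volume.restrict (ball D.center t)] 0 :=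
    (integral_eq_zero_iff_of_nonneg (fun _ => by positivity)
      (D.integrableOn_of_continuousOn D.continuousOn_energyDensity htR)).1 h.symm
  have h2 : Set.EqOn (fun z => ‖D.deriv z 1‖ ^ 2) 0 (ball D.center t) :=
    Measure.eqOn_open_of_ae_eq h1 isOpen_ball
      (D.continuousOn_energyDensity.mono
        (ball_subset_closedBall.trans (closedBall_subset_closedBall htR))) continuousOn_const
  have h4 : ‖D.deriv z 1‖ ^ 2 = 0 := h2 hz
  exact norm_eq_zero.1 ((pow_eq_zero_iff two_ne_zero).1 h4)

theorem energy_pos : 0 < D.energy D.radius := by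
  obtain ⟨z, hz, hne⟩ := D.exists_deriv_ne_zero
  exact D.energy_pos_of_deriv_ne_zero le_rfl hz hne

theorem area_pos : 0 < D.area := D.area_eq ▸ D.energy_pos

/-- The Jensen type integrals converge at `0`, since the inner integral is `O(t²)`. -/
theorem intervalIntegrable_jensen (φ : smoothForms Λ 2) :
    IntervalIntegrable (fun t : ℝ => (t : ℂ)⁻¹ * D.integral t φ) volume 0 D.radius := by
  rw [intervalIntegrable_iff_integrableOn_Ioc_of_le D.radius_pos.le]
  set g : ℂ → ℂ := fun z => D.pullback φ z ![1, Complex.I] with hg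
  have hgc : ContinuousOn g (closedBall D.center D.radius) := D.continuousOn_pullback φ
  obtain ⟨M, hM⟩ := (isCompact_closedBall D.center D.radius).exists_bound_of_continuousOn hgc
  have hM0 : 0 ≤ M := (norm_nonneg _).trans (hM _ (mem_closedBall_self D.radius_pos.le))
  have hmeas : AEStronglyMeasurable (fun t : ℝ => D.integral t φ)
      (volume.restrict (Set.Ioc 0 D.radius)) := by
    have hG : AEStronglyMeasurable ((closedBall D.center D.radius).indicator g) volume :=
      (aestronglyMeasurable_indicator_iff measurableSet_closedBall).2
        (hgc.aestronglyMeasurable measurableSet_closedBall)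
    have hset : MeasurableSet {p : ℝ × ℂ | dist p.2 D.center < p.1} :=
      measurableSet_lt (by fun_prop) (by fun_prop)
    have h1 := ((hG.comp_snd (μ := (volume : Measure ℝ))).indicator hset).integral_prod_right'
    refine h1.restrict.congr ?_
    filter_upwards [ae_restrict_mem measurableSet_Ioc] with t ht
    rw [integral, ← integral_indicator measurableSet_ball]
    refine integral_congr_ae (Eventually.of_forall fun z => ?_)
    by_cases hz : z ∈ ball D.center t
    · have h2 : (t, z) ∈ {p : ℝ × ℂ | dist p.2 D.center < p.1} := hz
      have h3 : z ∈ closedBall D.center D.radius :=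
        ball_subset_closedBall (ball_subset_ball ht.2 hz)
      simp only [Set.indicator_of_mem h2, Set.indicator_of_mem h3, Set.indicator_of_mem hz, hg]
    · have h2 : (t, z) ∉ {p : ℝ × ℂ | dist p.2 D.center < p.1} := hz
      simp only [Set.indicator_of_notMem h2, Set.indicator_of_notMem hz]
  refine Integrable.of_bound ((Complex.measurable_ofReal.inv.aestronglyMeasurable).mul hmeas)
    (M * Real.pi * D.radius) ?_
  filter_upwards [ae_restrict_mem measurableSet_Ioc] with t ht
  have h4 : ‖D.integral t φ‖ ≤ M * (Real.pi * t ^ 2) := by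
    have : ‖D.integral t φ‖ ≤ _ := norm_setIntegral_le_of_norm_le_const (μ := volume) (s := ball D.center t) (f := g)
      (C := M) measure_ball_lt_top
      (fun z hz => hM z (ball_subset_closedBall (ball_subset_ball ht.2 hz)))
    rw [measureReal_def, Complex.volume_ball] at this
    simpa [mul_comm, ht.1.le] using this
  rw [norm_mul, norm_inv, Complex.norm_real, Real.norm_of_nonneg ht.1.le,
    inv_mul_le_iff₀ ht.1]
  refine h4.trans ?_
  have h5 : t * t ≤ t * D.radius := mul_le_mul_of_nonneg_left ht.2 ht.1.le
  have h6 : 0 ≤ M * Real.pi := by positivity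
  nlinarith [mul_le_mul_of_nonneg_left h5 h6]

theorem jensen_omega :
    D.jensen (omega Λ) = ((∫ t in (0 : ℝ)..D.radius, t⁻¹ * D.energy t : ℝ) : ℂ) := by
  rw [jensen, ← intervalIntegral.integral_ofReal]
  refine intervalIntegral.integral_congr fun t ht => ?_
  rw [Set.uIcc_of_le D.radius_pos.le] at ht
  simp only [D.integral_omega ht.2]
  push_cast
  rfl

theorem nevArea_eq : D.nevArea = ∫ t in (0 : ℝ)..D.radius, t⁻¹ * D.energy t := by
  rw [nevArea, jensen_omega, Complex.ofReal_re]

theorem intervalIntegrable_energy :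
    IntervalIntegrable (fun t : ℝ => t⁻¹ * D.energy t) volume 0 D.radius := by
  have h := D.intervalIntegrable_jensen (omega Λ)
  rw [intervalIntegrable_iff_integrableOn_Ioc_of_le D.radius_pos.le] at h ⊢
  refine (IntegrableOn.congr_fun h.re (fun t ht => ?_) measurableSet_Ioc)
  simp only [D.integral_omega ht.2, ← Complex.ofReal_inv, ← Complex.ofReal_mul]
  rfl

theorem nevArea_pos : 0 < D.nevArea := by
  obtain ⟨z, hz, hne⟩ := D.exists_deriv_ne_zero
  have hnn : ∀ t : ℝ, 0 ≤ t → 0 ≤ t⁻¹ * D.energy t := fun t ht =>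
    mul_nonneg (inv_nonneg.2 ht) (D.energy_nonneg t)
  have h1 : Set.uIcc 0 (dist z D.center) ⊆ Set.uIcc 0 D.radius := by
    rw [Set.uIcc_of_le dist_nonneg, Set.uIcc_of_le D.radius_pos.le]
    exact Set.Icc_subset_Icc_right (mem_ball.1 hz).le
  have h2 : Set.uIcc (dist z D.center) D.radius ⊆ Set.uIcc 0 D.radius := by
    rw [Set.uIcc_of_le (mem_ball.1 hz).le, Set.uIcc_of_le D.radius_pos.le]
    exact Set.Icc_subset_Icc_left dist_nonneg
  rw [nevArea_eq, ← intervalIntegral.integral_add_adjacent_intervals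
    (D.intervalIntegrable_energy.mono_set h1) (D.intervalIntegrable_energy.mono_set h2)]
  refine add_pos_of_nonneg_of_pos
    (intervalIntegral.integral_nonneg dist_nonneg fun t ht => hnn t ht.1)
    (intervalIntegral.intervalIntegral_pos_of_pos_on (D.intervalIntegrable_energy.mono_set h2)
      (fun t ht => ?_) (mem_ball.1 hz))
  exact mul_pos (inv_pos.2 (dist_nonneg.trans_lt ht.1))
    (D.energy_pos_of_deriv_ne_zero ht.2.le ht.1 hne)

theorem norm_jensen_le (φ : smoothForms Λ 2) {B : ℝ} (hB : ∀ x, ‖lift φ x‖ ≤ B) :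
    ‖D.jensen φ‖ ≤ B * D.nevArea := by
  rw [nevArea_eq, jensen, ← intervalIntegral.integral_const_mul]
  refine intervalIntegral.norm_integral_le_of_norm_le D.radius_pos.le
    (Eventually.of_forall fun t ht => ?_) (D.intervalIntegrable_energy.const_mul B)
  rw [norm_mul, norm_inv, Complex.norm_real, Real.norm_of_nonneg ht.1.le, mul_left_comm]
  exact mul_le_mul_of_nonneg_left (D.norm_integral_le φ hB ht.2) (inv_nonneg.2 ht.1.le)

end HolDisc

/-! ### Normalized currents of integration -/

open scoped ComplexOrder

section Bounded

variable {n : ℕ} {Λ : Submodule ℤ (Cn n)} [DiscreteTopology Λ] [IsZLattice ℝ Λ] {k : ℕ}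

variable (Λ) in
theorem exists_norm_add_le : ∃ K : ℝ, ∀ x : Cn n, ∃ l ∈ Λ, ‖x + l‖ ≤ K := by
  let b := Module.Free.chooseBasis ℤ Λ
  let b' := b.ofZLatticeBasis ℝ Λ
  obtain ⟨K, hK⟩ := (ZSpan.fundamentalDomain_isBounded b').exists_norm_le
  refine ⟨K, fun x => ?_⟩
  obtain ⟨l, hl, -⟩ := ZSpan.exist_unique_vadd_mem_fundamentalDomain b' x
  have hmem : (l : Cn n) ∈ Λ := by
    have h := b.ofZLatticeBasis_span ℝ Λ
    exact h.le l.2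
  refine ⟨l, hmem, hK _ ?_⟩
  rw [add_comm]
  exact hl

/-- Smooth forms on the torus are bounded, by periodicity. -/
theorem exists_norm_lift_le (φ : smoothForms Λ k) : ∃ B : ℝ, ∀ x, ‖lift φ x‖ ≤ B := by
  obtain ⟨K, hK⟩ := exists_norm_add_le Λ
  obtain ⟨B, hB⟩ := (isCompact_closedBall (0 : Cn n) K).exists_bound_of_continuousOn
    (contDiff_lift φ).continuous.continuousOn
  refine ⟨B, fun x => ?_⟩
  obtain ⟨l, hl, hxl⟩ := hK x
  rw [← lift_add_mem φ hl x]
  exact hB _ (by simpa using hxl)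

end Bounded

section Means

variable {n : ℕ} {Λ : Submodule ℤ (Cn n)}

/-- The properties of the normalized currents of integration `ℓ` over a holomorphic disc with
length-area ratio `ε` that pass to the limit. -/
structure IsDiscMean (ℓ : smoothForms Λ 2 →ₗ[ℂ] ℂ) (ε : ℝ) : Prop where
  norm_le : ∀ φ B, (∀ x, ‖lift φ x‖ ≤ B) → ‖ℓ φ‖ ≤ B
  norm_d_le : ∀ (φ : smoothForms Λ 1) (B : ℝ), (∀ x, ‖lift φ x‖ ≤ B) → ‖ℓ (d φ)‖ ≤ B * ε
  nonneg : ∀ c : Cn n [⋀^Fin 2]→L[ℝ] ℂ, (∀ v, 0 ≤ c ![v, Complex.I • v]) → 0 ≤ ℓ (constForm Λ c)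
  omega : ℓ (omega Λ) = 1

namespace HolDisc

variable (D : HolDisc Λ)

theorem nevLength_integrand {t : ℝ} (ht : 0 < t) : t⁻¹ * D.length t =
    ∫ θ in (0 : ℝ)..(2 * Real.pi),
      ‖D.deriv (circleMap D.center t θ) (Complex.exp (θ * Complex.I) * Complex.I)‖ := by
  rw [length, ← intervalIntegral.integral_const_mul]
  congr 1
  funext θ
  have : circleMap 0 t θ * Complex.I = t • (Complex.exp (θ * Complex.I) * Complex.I) := by
    rw [circleMap_zero, Complex.real_smul, mul_assoc]
  rw [this, map_smul, norm_smul, Real.norm_of_nonneg ht.le, inv_mul_cancel_left₀ ht.ne']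

theorem integral_smul' (t : ℝ) (a : ℂ) (φ : smoothForms Λ 2) :
    D.integral t (a • φ) = a * D.integral t φ :=
  MeasureTheory.integral_const_mul a (fun z => D.pullback φ z ![1, Complex.I])

variable [DiscreteTopology Λ]

theorem intervalIntegrable_nevLength :
    IntervalIntegrable (fun t : ℝ => t⁻¹ * D.length t) volume 0 D.radius := by
  have hR := D.radius_pos
  -- Outside `[0, R]` the radius is clamped, so that the integrand is continuous everywhere.
  let ρ : ℝ → ℝ := fun t => max 0 (min t D.radius)
  have hρ : Continuous ρ := by fun_prop
  have hmem : ∀ p : ℝ × ℝ, circleMap D.center (ρ p.1) p.2 ∈ closedBall D.center D.radius :=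
    fun p => D.circleMap_mem (le_max_left _ _) (max_le hR.le (min_le_right _ _)) _
  have h1 : Continuous fun p : ℝ × ℝ => D.deriv (circleMap D.center (ρ p.1) p.2) :=
    D.continuousOn_deriv.comp_continuous (by simp only [circleMap]; fun_prop) hmem
  have h2 : Continuous fun t : ℝ => ∫ θ in (0 : ℝ)..(2 * Real.pi),
      ‖D.deriv (circleMap D.center (ρ t) θ) (Complex.exp (θ * Complex.I) * Complex.I)‖ := by
    refine intervalIntegral.continuous_parametric_intervalIntegral_of_continuous' ?_ _ _
    exact (h1.clm_apply (by fun_prop)).norm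
  have h3 := h2.intervalIntegrable (μ := volume) 0 D.radius
  rw [intervalIntegrable_iff_integrableOn_Ioc_of_le hR.le] at h3 ⊢
  refine h3.congr_fun (fun t ht => ?_) measurableSet_Ioc
  have : ρ t = t := by simp only [ρ, min_eq_left ht.2, max_eq_right ht.1.le]
  simp only [this, D.nevLength_integrand ht.1]

theorem norm_jensen_d_le (φ : smoothForms Λ 1) {B : ℝ} (hB : ∀ x, ‖lift φ x‖ ≤ B) :
    ‖D.jensen (d φ)‖ ≤ B * D.nevLength := by
  rw [nevLength, jensen, ← intervalIntegral.integral_const_mul]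
  refine intervalIntegral.norm_integral_le_of_norm_le D.radius_pos.le
    (Eventually.of_forall fun t ht => ?_) (D.intervalIntegrable_nevLength.const_mul B)
  rw [norm_mul, norm_inv, Complex.norm_real, Real.norm_of_nonneg ht.1.le, mul_left_comm]
  exact mul_le_mul_of_nonneg_left (D.norm_integral_d_le φ hB ht.1 ht.2) (inv_nonneg.2 ht.1.le)

theorem integral_add' {t : ℝ} (htR : t ≤ D.radius) (φ ψ : smoothForms Λ 2) :
    D.integral t (φ + ψ) = D.integral t φ + D.integral t ψ :=
  integral_add (D.integrableOn_of_continuousOn (D.continuousOn_pullback φ) htR)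
    (D.integrableOn_of_continuousOn (D.continuousOn_pullback ψ) htR)

/-- The normalized current of integration on the disc. -/
def ahlforsMean : smoothForms Λ 2 →ₗ[ℂ] ℂ where
  toFun φ := (D.area : ℂ)⁻¹ * D.integral D.radius φ
  map_add' φ ψ := by rw [D.integral_add' le_rfl, mul_add]
  map_smul' a φ := by
    rw [integral_smul', RingHom.id_apply, smul_eq_mul, mul_left_comm]

/-- The normalized Nevanlinna current of the disc. -/
def nevanlinnaMean : smoothForms Λ 2 →ₗ[ℂ] ℂ where
  toFun φ := (D.nevArea : ℂ)⁻¹ * D.jensen φ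
  map_add' φ ψ := by
    rw [← mul_add, jensen, jensen, jensen, ← intervalIntegral.integral_add
      (D.intervalIntegrable_jensen φ) (D.intervalIntegrable_jensen ψ)]
    congr 1
    refine intervalIntegral.integral_congr fun t ht => ?_
    rw [Set.uIcc_of_le D.radius_pos.le] at ht
    simp only [D.integral_add' ht.2, mul_add]
  map_smul' a φ := by
    have h : D.jensen (a • φ) = a * D.jensen φ := by
      rw [jensen, jensen, ← intervalIntegral.integral_const_mul]
      simp only [integral_smul', mul_left_comm a]
    rw [RingHom.id_apply, smul_eq_mul, mul_left_comm, h]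

theorem integral_constForm_nonneg {c : Cn n [⋀^Fin 2]→L[ℝ] ℂ}
    (hc : ∀ v, 0 ≤ c ![v, Complex.I • v]) {t : ℝ} (htR : t ≤ D.radius) :
    0 ≤ D.integral t (constForm Λ c) := by
  refine integral_nonneg_of_ae ?_
  filter_upwards [ae_restrict_mem measurableSet_ball] with z hz
  rw [D.pullback_apply (ball_subset_ball htR hz), constForm_apply]
  exact hc _

theorem isDiscMean_ahlforsMean :
    IsDiscMean D.ahlforsMean (D.length D.radius / D.area) where
  norm_le φ B hB := by
    change ‖(D.area : ℂ)⁻¹ * D.integral D.radius φ‖ ≤ B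
    rw [norm_mul, norm_inv, Complex.norm_real, Real.norm_of_nonneg D.area_pos.le,
      inv_mul_le_iff₀ D.area_pos, mul_comm, area_eq]
    exact D.norm_integral_le φ hB le_rfl
  norm_d_le φ B hB := by
    change ‖(D.area : ℂ)⁻¹ * D.integral D.radius (d φ)‖ ≤ _
    rw [norm_mul, norm_inv, Complex.norm_real, Real.norm_of_nonneg D.area_pos.le, ← mul_div_assoc,
      inv_mul_le_iff₀ D.area_pos, mul_div_cancel₀ _ D.area_pos.ne']
    exact D.norm_integral_d_le φ hB D.radius_pos le_rfl
  nonneg c hc := by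
    refine mul_nonneg ?_ (D.integral_constForm_nonneg hc le_rfl)
    rw [← Complex.ofReal_inv, Complex.zero_le_real]
    exact inv_nonneg.2 D.area_pos.le
  omega := by
    change (D.area : ℂ)⁻¹ * D.integral D.radius (ComplexTorus.omega Λ) = 1
    rw [D.integral_omega le_rfl, ← area_eq]
    exact inv_mul_cancel₀ (Complex.ofReal_ne_zero.2 D.area_pos.ne')

theorem isDiscMean_nevanlinnaMean :
    IsDiscMean D.nevanlinnaMean (D.nevLength / D.nevArea) where
  norm_le φ B hB := by
    change ‖(D.nevArea : ℂ)⁻¹ * D.jensen φ‖ ≤ B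
    rw [norm_mul, norm_inv, Complex.norm_real, Real.norm_of_nonneg D.nevArea_pos.le,
      inv_mul_le_iff₀ D.nevArea_pos, mul_comm]
    exact D.norm_jensen_le φ hB
  norm_d_le φ B hB := by
    change ‖(D.nevArea : ℂ)⁻¹ * D.jensen (d φ)‖ ≤ _
    rw [norm_mul, norm_inv, Complex.norm_real, Real.norm_of_nonneg D.nevArea_pos.le,
      ← mul_div_assoc, inv_mul_le_iff₀ D.nevArea_pos, mul_div_cancel₀ _ D.nevArea_pos.ne']
    exact D.norm_jensen_d_le φ hB
  nonneg c hc := by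
    refine mul_nonneg ?_ ?_
    · rw [← Complex.ofReal_inv, Complex.zero_le_real]
      exact inv_nonneg.2 D.nevArea_pos.le
    · rw [jensen, intervalIntegral.integral_of_le D.radius_pos.le]
      refine integral_nonneg_of_ae ?_
      filter_upwards [ae_restrict_mem measurableSet_Ioc] with t ht
      refine mul_nonneg ?_ (D.integral_constForm_nonneg hc ht.2)
      rw [← Complex.ofReal_inv, Complex.zero_le_real]
      exact inv_nonneg.2 ht.1.le
  omega := by
    change (D.nevArea : ℂ)⁻¹ * D.jensen (ComplexTorus.omega Λ) = 1
    rw [jensen_omega, ← nevArea_eq]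
    exact inv_mul_cancel₀ (Complex.ofReal_ne_zero.2 D.nevArea_pos.ne')

end HolDisc

/-- A current that is a weak limit of normalized currents of integration whose length-area ratios
tend to `0`. -/
def IsMeanLimit (T : currents Λ 2) : Prop :=
  ∃ (ℓ : ℕ → smoothForms Λ 2 →ₗ[ℂ] ℂ) (ε : ℕ → ℝ), (∀ j, IsDiscMean (ℓ j) (ε j)) ∧
    Tendsto ε atTop (𝓝 0) ∧ ∀ φ, Tendsto (fun j => ℓ j φ) atTop (𝓝 (T.1 φ))

namespace IsMeanLimit

variable {T : currents Λ 2}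

theorem of_ahlforsLimit [DiscreteTopology Λ] {D : ℕ → HolDisc Λ} (h : AhlforsLimit D T) :
    IsMeanLimit T :=
  ⟨fun j => (D j).ahlforsMean, _, fun j => (D j).isDiscMean_ahlforsMean, h⟩

theorem of_nevanlinnaLimit [DiscreteTopology Λ] {D : ℕ → HolDisc Λ} (h : NevanlinnaLimit D T) :
    IsMeanLimit T :=
  ⟨fun j => (D j).nevanlinnaMean, _, fun j => (D j).isDiscMean_nevanlinnaMean, h⟩

theorem isClosedCurrent [DiscreteTopology Λ] [IsZLattice ℝ Λ] (h : IsMeanLimit T) :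
    IsClosedCurrent T := by
  obtain ⟨ℓ, ε, hℓ, hε, hT⟩ := h
  intro φ
  obtain ⟨B, hB⟩ := exists_norm_lift_le φ
  refine tendsto_nhds_unique (hT (d φ)) (squeeze_zero_norm (fun j => (hℓ j).norm_d_le φ B hB) ?_)
  simpa using hε.const_mul B

theorem omega (h : IsMeanLimit T) : T.1 (omega Λ) = 1 := by
  obtain ⟨ℓ, ε, hℓ, hε, hT⟩ := h
  refine tendsto_nhds_unique (hT _) ?_
  simp only [(hℓ _).omega]
  exact tendsto_const_nhds

theorem nonneg (h : IsMeanLimit T) {c : Cn n [⋀^Fin 2]→L[ℝ] ℂ}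
    (hc : ∀ v, 0 ≤ c ![v, Complex.I • v]) : 0 ≤ T.1 (constForm Λ c) := by
  obtain ⟨ℓ, ε, hℓ, hε, hT⟩ := h
  exact ge_of_tendsto' (hT _) fun j => (hℓ j).nonneg c hc

end IsMeanLimit

end Means

/-! ### Compactness and affine curves -/

section Compactness

instance instFiniteDimensionalAlternating (n k : ℕ) :
    FiniteDimensional ℝ (Cn n [⋀^Fin k]→L[ℝ] ℂ) := by
  let f : (Cn n [⋀^Fin k]→L[ℝ] ℂ) →ₗ[ℝ] MultilinearMap ℝ (fun _ : Fin k => Cn n) ℂ :=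
    { toFun := fun c => c.toMultilinearMap
      map_add' := fun _ _ => rfl
      map_smul' := fun _ _ => rfl }
  refine Module.Finite.of_injective f fun c c' h => ?_
  ext v
  exact congrArg (fun g : MultilinearMap ℝ (fun _ : Fin k => Cn n) ℂ => g v) h

variable {n : ℕ} {Λ : Submodule ℤ (Cn n)} [DiscreteTopology Λ] [IsZLattice ℝ Λ]

variable (Λ) in
/-- The smooth forms are separable for uniform convergence. -/
theorem exists_dense_seq (k : ℕ) : ∃ φ : ℕ → smoothForms Λ k, ∀ (ψ : smoothForms Λ k) (ε : ℝ),
    0 < ε → ∃ i, ∀ x, ‖lift (ψ - φ i) x‖ ≤ ε := by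
  obtain ⟨K, hK⟩ := exists_norm_add_le Λ
  have : CompactSpace (closedBall (0 : Cn n) K) :=
    isCompact_iff_compactSpace.1 (isCompact_closedBall _ _)
  have : ProperSpace (Cn n [⋀^Fin k]→L[ℝ] ℂ) := FiniteDimensional.proper ℝ _
  let ι : smoothForms Λ k → C(closedBall (0 : Cn n) K, Cn n [⋀^Fin k]→L[ℝ] ℂ) := fun φ =>
    ⟨fun x => lift φ x, (contDiff_lift φ).continuous.comp continuous_subtype_val⟩
  have : Nonempty (Set.range ι) := ⟨⟨ι 0, 0, rfl⟩⟩
  choose φ hφ using fun i => (TopologicalSpace.denseSeq (Set.range ι) i).2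
  refine ⟨φ, fun ψ ε hε => ?_⟩
  obtain ⟨i, hi⟩ := DenseRange.exists_dist_lt (α := Set.range ι)
    (f := TopologicalSpace.denseSeq (Set.range ι))
    (TopologicalSpace.denseRange_denseSeq (Set.range ι)) ⟨ι ψ, ψ, rfl⟩ hε
  refine ⟨i, fun x => ?_⟩
  rw [Subtype.dist_eq, ← hφ i] at hi
  obtain ⟨l, hl, hxl⟩ := hK x
  rw [← lift_add_mem _ hl x]
  have h1 := (ContinuousMap.dist_apply_le_dist (f := ι ψ) (g := ι (φ i))
    ⟨x + l, by simpa using hxl⟩).trans hi.le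
  rw [dist_eq_norm] at h1
  exact h1

/-- Sequential compactness of the currents of order zero with a bound on their mass. -/
theorem exists_subseq_tendsto {ℓ : ℕ → smoothForms Λ 2 →ₗ[ℂ] ℂ}
    (hℓ : ∀ j φ B, (∀ x, ‖lift φ x‖ ≤ B) → ‖ℓ j φ‖ ≤ B) :
    ∃ (T : currents Λ 2) (σ : ℕ → ℕ), StrictMono σ ∧
      ∀ φ, Tendsto (fun j => ℓ (σ j) φ) atTop (𝓝 (T.1 φ)) := by
  obtain ⟨Φ, hΦ⟩ := exists_dense_seq Λ 2
  choose B hB using fun i => exists_norm_lift_le (Φ i)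
  have hcpt : IsCompact (Set.univ.pi fun i => closedBall (0 : ℂ) (B i)) :=
    isCompact_univ_pi fun i => isCompact_closedBall _ _
  obtain ⟨u, -, σ, hσ, hu⟩ := hcpt.tendsto_subseq (x := fun j i => ℓ j (Φ i))
    (fun j i _ => by simpa using hℓ j (Φ i) (B i) (hB i))
  rw [tendsto_pi_nhds] at hu
  have hlim : ∀ φ, ∃ a, Tendsto (fun j => ℓ (σ j) φ) atTop (𝓝 a) := by
    intro φ
    refine cauchySeq_tendsto_of_complete (Metric.cauchySeq_iff.2 fun ε hε => ?_)
    obtain ⟨i, hi⟩ := hΦ φ (ε / 4) (by positivity)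
    obtain ⟨N, hN⟩ := Metric.cauchySeq_iff.1 (hu i).cauchySeq (ε / 4) (by positivity)
    refine ⟨N, fun a ha b hb => ?_⟩
    have h1 : ∀ j, dist (ℓ j φ) (ℓ j (Φ i)) ≤ ε / 4 := fun j => by
      rw [dist_eq_norm, ← map_sub]
      exact hℓ j _ _ hi
    have h2 := dist_triangle4 (ℓ (σ a) φ) (ℓ (σ a) (Φ i)) (ℓ (σ b) (Φ i)) (ℓ (σ b) φ)
    have h3 := hN a ha b hb
    have h4 := h1 (σ a)
    have h5 := h1 (σ b)
    rw [dist_comm] at h5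
    simp only [Function.comp_apply] at h3
    linarith
  choose T hT using hlim
  refine ⟨⟨{ toFun := T, map_add' := fun φ ψ => ?_, map_smul' := fun c φ => ?_ }, 0, 1,
    fun φ C hC => ?_⟩, σ, hσ, hT⟩
  · refine tendsto_nhds_unique (hT _) ?_
    simp only [map_add]
    exact (hT φ).add (hT ψ)
  · refine tendsto_nhds_unique (hT _) ?_
    simp only [map_smul]
    exact (hT φ).const_smul c
  · rw [one_mul]
    refine le_of_tendsto' (hT φ).norm fun j => hℓ _ _ _ fun x => ?_
    simpa using hC 0 le_rfl x

end Compactness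

section Affine

variable {n : ℕ} {Λ : Submodule ℤ (Cn n)}

/-- The differential `h ↦ h v` of an affine curve. -/
def affineDeriv (v : Cn n) : ℂ →L[ℝ] Cn n :=
  ((1 : ℂ →L[ℂ] ℂ).smulRight v).restrictScalars ℝ

theorem affineDeriv_apply (v : Cn n) (h : ℂ) : affineDeriv v h = h • v := rfl

theorem hasFDerivAt_affine (v c : Cn n) (z : ℂ) :
    HasFDerivAt (fun z : ℂ => z • v + c) (affineDeriv v) z :=
  ((affineDeriv v).hasFDerivAt (x := z)).add_const c

variable [DiscreteTopology Λ]

/-- The restriction of a nonconstant affine curve to a disc centred at the origin. -/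
def affineDisc {v : Cn n} (hv : v ≠ 0) (c : Cn n) {r : ℝ} (hr : 0 < r) : HolDisc Λ where
  center := 0
  radius := r
  radius_pos := hr
  toFun := affineCurve Λ v c
  smooth z _ := ⟨fun z => z • v + c,
    ((contDiff_id.smul contDiff_const).add contDiff_const).contDiffWithinAt,
    Eventually.of_forall fun _ => rfl⟩
  holomorphic z _ := ⟨fun z => z • v + c, Eventually.of_forall fun w =>
    ((differentiableAt_id.smul_const v).add_const c), Eventually.of_forall fun _ => rfl⟩
  nonconstant := by
    obtain ⟨ε, hε, hΛ⟩ := Metric.isOpen_singleton_iff.1 (isOpen_discrete {(0 : Λ)})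
    have hv' : 0 < ‖v‖ := norm_pos_iff.2 hv
    -- a scalar so small that `δ v` is a nonzero vector shorter than all nonzero periods
    set δ : ℝ := min r (ε / (2 * ‖v‖)) with hδ
    have hδ0 : 0 < δ := lt_min hr (by positivity)
    refine ⟨(δ : ℂ), ?_, 0, mem_closedBall_self hr.le, fun h => ?_⟩
    · rw [mem_closedBall, dist_zero_right, Complex.norm_real, Real.norm_of_nonneg hδ0.le]
      exact min_le_left _ _
    · rw [affineCurve, affineCurve, proj_eq_proj_iff, zero_smul, zero_add, add_sub_cancel_right]
        at h
      have hlt : ‖(δ : ℂ) • v‖ < ε := by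
        rw [norm_smul, Complex.norm_real, Real.norm_of_nonneg hδ0.le]
        calc δ * ‖v‖ ≤ ε / (2 * ‖v‖) * ‖v‖ := mul_le_mul_of_nonneg_right (min_le_right _ _) hv'.le
          _ = ε / 2 := by field_simp
          _ < ε := by linarith
      have h0 := congrArg Subtype.val (hΛ ⟨(δ : ℂ) • v, h⟩ (by simpa [Subtype.dist_eq] using hlt))
      exact (smul_ne_zero (Complex.ofReal_ne_zero.2 hδ0.ne') hv) h0

theorem HolDisc.deriv_affineCurve {D : HolDisc Λ} {v c : Cn n} (hD : D.toFun = affineCurve Λ v c)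
    {z : ℂ} (hz : z ∈ closedBall D.center D.radius) (h : ℂ) : D.deriv z h = h • v := by
  have : D.deriv z = affineDeriv v := by
    refine fderivTorus_eq hz (D.uniqueDiffOn z hz) ⟨fun z => z • v + c,
      (hasFDerivAt_affine v c z).hasFDerivWithinAt, Eventually.of_forall fun w => ?_⟩
    rw [hD]
    rfl
  rw [this, affineDeriv_apply]

theorem HolDisc.length_affineCurve {D : HolDisc Λ} {v c : Cn n}
    (hD : D.toFun = affineCurve Λ v c) {t : ℝ} (ht : 0 ≤ t) (htR : t ≤ D.radius) :
    D.length t = 2 * Real.pi * ‖v‖ * t := by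
  have : ∀ θ, ‖D.deriv (circleMap D.center t θ) (circleMap 0 t θ * Complex.I)‖ = t * ‖v‖ := by
    intro θ
    rw [D.deriv_affineCurve hD (D.circleMap_mem ht htR θ), norm_smul, norm_mul, Complex.norm_I,
      norm_circleMap_zero, abs_of_nonneg ht, mul_one]
  rw [HolDisc.length]
  simp only [this, intervalIntegral.integral_const, sub_zero, smul_eq_mul]
  ring

theorem HolDisc.energy_affineCurve {D : HolDisc Λ} {v c : Cn n}
    (hD : D.toFun = affineCurve Λ v c) {t : ℝ} (ht : 0 ≤ t) (htR : t ≤ D.radius) :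
    D.energy t = Real.pi * ‖v‖ ^ 2 * t ^ 2 := by
  have : ∀ z ∈ ball D.center t, ‖D.deriv z 1‖ ^ 2 = ‖v‖ ^ 2 := by
    intro z hz
    rw [D.deriv_affineCurve hD (ball_subset_closedBall (ball_subset_ball htR hz)), one_smul]
  rw [HolDisc.energy, setIntegral_congr_fun measurableSet_ball this, setIntegral_const,
    measureReal_def, Complex.volume_ball]
  simp [ht]
  ring

theorem HolDisc.nevLength_affineCurve {D : HolDisc Λ} {v c : Cn n}
    (hD : D.toFun = affineCurve Λ v c) : D.nevLength = 2 * Real.pi * ‖v‖ * D.radius := by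
  have h : D.nevLength = ∫ _ in (0 : ℝ)..D.radius, 2 * Real.pi * ‖v‖ := by
    rw [HolDisc.nevLength]
    refine intervalIntegral.integral_congr_ae (Eventually.of_forall fun t ht => ?_)
    rw [Set.uIoc_of_le D.radius_pos.le] at ht
    rw [D.length_affineCurve hD ht.1.le ht.2]
    field_simp [ht.1.ne']
  rw [h, intervalIntegral.integral_const, sub_zero, smul_eq_mul, mul_comm]

theorem HolDisc.nevArea_affineCurve {D : HolDisc Λ} {v c : Cn n}
    (hD : D.toFun = affineCurve Λ v c) : D.nevArea = Real.pi * ‖v‖ ^ 2 * D.radius ^ 2 / 2 := by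
  have h : D.nevArea = ∫ t in (0 : ℝ)..D.radius, Real.pi * ‖v‖ ^ 2 * t := by
    rw [HolDisc.nevArea_eq]
    refine intervalIntegral.integral_congr_ae (Eventually.of_forall fun t ht => ?_)
    rw [Set.uIoc_of_le D.radius_pos.le] at ht
    rw [D.energy_affineCurve hD ht.1.le ht.2]
    field_simp [ht.1.ne']
  rw [h, intervalIntegral.integral_const_mul, integral_id]
  ring

theorem exhausts_affineDisc {v : Cn n} (hv : v ≠ 0) (c : Cn n) {σ : ℕ → ℕ} (hσ : StrictMono σ) :
    Exhausts (fun j => affineDisc (Λ := Λ) hv c (r := (σ j : ℝ) + 1) (by positivity))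
      (affineCurve Λ v c) := by
  refine ⟨fun j => ⟨rfl, rfl⟩, fun i j hij => ?_, ?_⟩
  · change (σ i : ℝ) + 1 < σ j + 1
    have : (σ i : ℝ) < σ j := Nat.cast_lt.2 (hσ hij)
    linarith
  · exact tendsto_atTop_add_const_right _ _ (tendsto_natCast_atTop_atTop.comp hσ.tendsto_atTop)

theorem tendsto_const_div_succ (a : ℝ) {σ : ℕ → ℕ} (hσ : StrictMono σ) :
    Tendsto (fun j => a / ((σ j : ℝ) + 1)) atTop (𝓝 0) :=
  tendsto_const_nhds.div_atTop
    (tendsto_atTop_add_const_right _ _ (tendsto_natCast_atTop_atTop.comp hσ.tendsto_atTop))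

variable [IsZLattice ℝ Λ]

theorem exists_isAhlforsCurrentOf_affineCurve {v : Cn n} (hv : v ≠ 0) (c : Cn n) :
    ∃ A, IsAhlforsCurrentOf (affineCurve Λ v c) A := by
  let D : ℕ → HolDisc Λ := fun j => affineDisc hv c (r := (j : ℝ) + 1) (by positivity)
  obtain ⟨T, σ, hσ, hT⟩ := exists_subseq_tendsto (ℓ := fun j => (D j).ahlforsMean)
    (fun j => (D j).isDiscMean_ahlforsMean.norm_le)
  refine ⟨T, fun j => D (σ j), exhausts_affineDisc hv c hσ, ?_, hT⟩
  refine (tendsto_const_div_succ (2 / ‖v‖) hσ).congr fun j => ?_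
  have hr : (D (σ j)).radius = (σ j : ℝ) + 1 := rfl
  have hv' : ‖v‖ ≠ 0 := norm_ne_zero_iff.2 hv
  have h1 : (σ j : ℝ) + 1 ≠ 0 := by positivity
  have hpi := Real.pi_ne_zero
  rw [HolDisc.area_eq, (D (σ j)).energy_affineCurve rfl (D (σ j)).radius_pos.le le_rfl,
    (D (σ j)).length_affineCurve rfl (D (σ j)).radius_pos.le le_rfl, hr]
  field_simp

theorem exists_isNevanlinnaCurrentOf_affineCurve {v : Cn n} (hv : v ≠ 0) (c : Cn n) :
    ∃ N, IsNevanlinnaCurrentOf (affineCurve Λ v c) N := by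
  let D : ℕ → HolDisc Λ := fun j => affineDisc hv c (r := (j : ℝ) + 1) (by positivity)
  obtain ⟨T, σ, hσ, hT⟩ := exists_subseq_tendsto (ℓ := fun j => (D j).nevanlinnaMean)
    (fun j => (D j).isDiscMean_nevanlinnaMean.norm_le)
  refine ⟨T, fun j => D (σ j), exhausts_affineDisc hv c hσ, ?_, hT⟩
  refine (tendsto_const_div_succ (4 / ‖v‖) hσ).congr fun j => ?_
  have hr : (D (σ j)).radius = (σ j : ℝ) + 1 := rfl
  have hv' : ‖v‖ ≠ 0 := norm_ne_zero_iff.2 hv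
  have h1 : (σ j : ℝ) + 1 ≠ 0 := by positivity
  have hpi := Real.pi_ne_zero
  rw [(D (σ j)).nevLength_affineCurve rfl, (D (σ j)).nevArea_affineCurve rfl, hr]
  field_simp
  norm_num

end Affine

/-! ### The Hermitian matrix of a current -/

section LinearAlgebra

variable {n : ℕ}

/-- The alternating form `(i/2) dz_a ∧ dz̄_b`. -/
def elemForm (a b : Fin n) : Cn n [⋀^Fin 2]→L[ℝ] ℂ where
  toFun u := Complex.I / 2 * (u 0 a * star (u 1 b) - u 1 a * star (u 0 b))
  map_update_add' u i x y := by
    fin_cases i <;> simp [mul_add, add_mul, Function.update] <;> ring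
  map_update_smul' u i r x := by
    fin_cases i <;> simp [Function.update] <;> ring
  map_eq_zero_of_eq' u i j h hij := by
    fin_cases i <;> fin_cases j <;> simp_all
  cont := by fun_prop

theorem elemForm_apply_I (a b : Fin n) (v : Cn n) :
    elemForm a b ![v, Complex.I • v] = v a * star (v b) := by
  change Complex.I / 2 * (v a * star ((Complex.I • v) b) - (Complex.I • v) a * star (v b)) = _
  rw [PiLp.smul_apply, PiLp.smul_apply, smul_eq_mul, smul_eq_mul, star_mul']
  simp only [Complex.star_def, Complex.conj_I]
  linear_combination (-(v a * (starRingEnd ℂ) (v b))) * Complex.I_sq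

/-- A real linear form that intertwines `i` with multiplication by `j` intertwines every complex
scalar `x + i y` with multiplication by `x + y j`. It is used with `j = i` and `j = -i`. -/
theorem map_smul_of_map_I_smul {L : Cn n →L[ℝ] ℂ} {j : ℂ} {f : ℂ → ℂ}
    (hf : ∀ z : ℂ, f z = z.re + z.im * j) (hL : ∀ u, L (Complex.I • u) = j * L u) (z : ℂ)
    (u : Cn n) : L (z • u) = f z * L u := by
  have h : z • u = z.re • u + z.im • (Complex.I • u) := by
    rw [← Complex.coe_smul z.re, ← Complex.coe_smul z.im, smul_smul, ← add_smul, Complex.re_add_im]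
  rw [h, map_add, map_smul, map_smul, hL, hf, Complex.real_smul, Complex.real_smul]
  ring

/-- On complex lines every alternating form is given by a sesquilinear form, its component of type
`(1,1)`. -/
theorem exists_coeff (c : Cn n [⋀^Fin 2]→L[ℝ] ℂ) : ∃ C : Fin n → Fin n → ℂ, ∀ v : Cn n,
    c ![v, Complex.I • v] = ∑ a, ∑ b, C a b * (v a * star (v b)) := by
  let β : Cn n →L[ℝ] Cn n →L[ℝ] ℂ := oneFormCLM.comp c.curryLeft
  have hβ : ∀ u w, β u w = c ![u, w] := fun _ _ => rfl
  have hself : ∀ u, β u u = 0 := fun u => by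
    rw [hβ]
    exact c.map_eq_zero_of_eq _ (i := 0) (j := 1) rfl (by simp)
  have hII : ∀ u : Cn n, Complex.I • Complex.I • u = -u := fun u => by
    rw [smul_smul, Complex.I_mul_I, neg_one_smul]
  let J : Cn n →L[ℝ] Cn n := (Complex.I • ContinuousLinearMap.id ℂ (Cn n)).restrictScalars ℝ
  -- twice the sesquilinear form whose diagonal is `v ↦ c (v, i v)`
  let G : Cn n →L[ℝ] Cn n →L[ℝ] ℂ :=
    (β.flip.comp J).flip - β.comp J - Complex.I • β - Complex.I • (((β.comp J).flip.comp J).flip)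
  have hG : ∀ u w, G u w = β u (Complex.I • w) - β (Complex.I • u) w - Complex.I * β u w -
      Complex.I * β (Complex.I • u) (Complex.I • w) := fun _ _ => rfl
  have hG1 : ∀ u w, G (Complex.I • u) w = Complex.I * G u w := by
    intro u w
    simp only [hG, hII, map_neg, neg_apply]
    linear_combination (β u w + β (Complex.I • u) (Complex.I • w)) * Complex.I_sq
  have hG2 : ∀ u w, G u (Complex.I • w) = -Complex.I * G u w := by
    intro u w
    simp only [hG, hII, map_neg]
    linear_combination -(β u w + β (Complex.I • u) (Complex.I • w)) * Complex.I_sq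
  have hs1 : ∀ (z : ℂ) u w, G (z • u) w = z * G u w := fun z u w =>
    map_smul_of_map_I_smul (L := G.flip w) (f := id) (j := Complex.I)
      (fun z => (Complex.re_add_im z).symm) (fun u => hG1 u w) z u
  have hs2 : ∀ (z : ℂ) u w, G u (z • w) = star z * G u w := fun z u w =>
    map_smul_of_map_I_smul (L := G u) (f := star) (j := -Complex.I)
      (fun z => by apply Complex.ext <;> simp) (fun w => hG2 u w) z w
  let e : Fin n → Cn n := fun a => EuclideanSpace.single a 1
  have hsum : ∀ v : Cn n, v = ∑ a, v a • e a := by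
    intro v
    have := (EuclideanSpace.basisFun (Fin n) ℂ).sum_repr v
    simpa [e] using this.symm
  refine ⟨fun a b => G (e a) (e b) / 2, fun v => ?_⟩
  have h1 : G v v = ∑ a, ∑ b, v a * (star (v b) * G (e a) (e b)) := by
    conv_lhs => rw [hsum v]
    simp only [map_sum, sum_apply, hs1, hs2]
    rw [Finset.sum_comm]
  have hanti : β (Complex.I • v) v = -β v (Complex.I • v) := by
    have := hself (v + Complex.I • v)
    simp only [map_add, add_apply, hself] at this
    linear_combination this
  have h2 : G v v = 2 * c ![v, Complex.I • v] := by
    rw [hG, hself, hself, hanti, hβ]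
    ring
  rw [← mul_right_inj' (two_ne_zero (α := ℂ)), ← h2, h1, Finset.mul_sum]
  refine Finset.sum_congr rfl fun a _ => ?_
  rw [Finset.mul_sum]
  exact Finset.sum_congr rfl fun b _ => by ring

theorem sum_smul_elemForm_apply_I (C : Fin n → Fin n → ℂ) (v : Cn n) :
    (∑ a, ∑ b, C a b • elemForm a b) ![v, Complex.I • v] =
      ∑ a, ∑ b, C a b * (v a * star (v b)) := by
  simp [ContinuousAlternatingMap.sum_apply, elemForm_apply_I]

variable {Λ : Submodule ℤ (Cn n)}

/-- The value of a current on translation invariant forms. -/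
def constPart (T : currents Λ 2) : (Cn n [⋀^Fin 2]→L[ℝ] ℂ) →ₗ[ℂ] ℂ :=
  T.1 ∘ₗ { toFun := constForm Λ, map_add' := fun _ _ => rfl, map_smul' := fun _ _ => rfl }

theorem constPart_apply (T : currents Λ 2) (c : Cn n [⋀^Fin 2]→L[ℝ] ℂ) :
    constPart T c = T.1 (constForm Λ c) := rfl

namespace IsMeanLimit

variable {T : currents Λ 2}

/-- Limits of holomorphic discs only see the restrictions of forms to complex lines. -/
theorem constPart_congr (hT : IsMeanLimit T) {c c' : Cn n [⋀^Fin 2]→L[ℝ] ℂ}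
    (h : ∀ v, c ![v, Complex.I • v] = c' ![v, Complex.I • v]) : constPart T c = constPart T c' := by
  refine le_antisymm ?_ ?_ <;> rw [← sub_nonneg, ← map_sub] <;> refine hT.nonneg fun v => ?_ <;>
    rw [ContinuousAlternatingMap.sub_apply, h, sub_self]

theorem constPart_eq_sum (hT : IsMeanLimit T) {c : Cn n [⋀^Fin 2]→L[ℝ] ℂ} {C : Fin n → Fin n → ℂ}
    (hC : ∀ v : Cn n, c ![v, Complex.I • v] = ∑ a, ∑ b, C a b * (v a * star (v b))) :
    constPart T c = ∑ a, ∑ b, C a b * constPart T (elemForm a b) := by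
  rw [hT.constPart_congr (c' := ∑ a, ∑ b, C a b • elemForm a b)
    (fun v => by rw [hC, sum_smul_elemForm_apply_I])]
  simp

/-- The matrix of values of a current on the forms `(i/2) dz_a ∧ dz̄_b`. For a limit of discs with
local lifts `f` it is the limit of the normalized integrals of `f' (f')^*`. -/
def matrix (T : currents Λ 2) : Matrix (Fin n) (Fin n) ℂ :=
  Matrix.of fun a b => constPart T (elemForm a b)

theorem posSemidef_matrix (hT : IsMeanLimit T) : (matrix T).PosSemidef := by
  rw [← Matrix.isPositive_toEuclideanLin_iff, LinearMap.isPositive_iff_complex]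
  intro x
  have h : 0 ≤ inner ℂ ((matrix T).toEuclideanLin x) x := by
    have h1 : 0 ≤ constPart T (∑ a, ∑ b, (x b * star (x a)) • elemForm a b) := by
      refine hT.nonneg fun v => ?_
      rw [sum_smul_elemForm_apply_I]
      have : ∑ a, ∑ b, x b * star (x a) * (v a * star (v b)) =
          (∑ a, star (x a) * v a) * star (∑ b, star (x b) * v b) := by
        rw [star_sum, Finset.sum_mul_sum]
        refine Finset.sum_congr rfl fun a _ => Finset.sum_congr rfl fun b _ => ?_
        rw [star_mul', star_star]
        ring
      rw [this]
      exact mul_star_self_nonneg _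
    have h2 : inner ℂ x ((matrix T).toEuclideanLin x) =
        constPart T (∑ a, ∑ b, (x b * star (x a)) • elemForm a b) := by
      simp only [map_sum, map_smul, smul_eq_mul]
      rw [PiLp.inner_apply]
      refine Finset.sum_congr rfl fun a _ => ?_
      simp [Matrix.mulVec, dotProduct, matrix, mul_comm, mul_left_comm, Finset.mul_sum]
      exact Finset.sum_congr rfl fun b _ => by ring
    rw [← inner_conj_symm, h2]
    rw [← star_nonneg_iff] at h1
    exact h1
  obtain ⟨h1, h2⟩ := Complex.nonneg_iff.1 h
  exact ⟨Complex.ext rfl (by simpa using h2), h1⟩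

/-- By the spectral theorem for its matrix, the current acts on translation invariant forms as a
convex combination of restrictions to orthogonal complex lines. -/
theorem exists_orthonormalBasis (hT : IsMeanLimit T) :
    ∃ (v : OrthonormalBasis (Fin n) ℂ (Cn n)) (β : Fin n → ℝ), (∀ s, 0 ≤ β s) ∧ ∑ s, β s = 1 ∧
      ∀ c : Cn n [⋀^Fin 2]→L[ℝ] ℂ,
        constPart T c = ∑ s, (β s : ℂ) * c ![v s, Complex.I • v s] := by
  have hM := hT.posSemidef_matrix
  have hentry : ∀ a b, constPart T (elemForm a b) =
      ∑ s, (hM.1.eigenvalues s : ℂ) *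
        (hM.1.eigenvectorBasis s a * star (hM.1.eigenvectorBasis s b)) := by
    intro a b
    have h := congrFun (congrFun hM.1.spectral_theorem a) b
    rw [Unitary.conjStarAlgAut_apply, Matrix.mul_apply] at h
    change constPart T (elemForm a b) = _ at h
    rw [h]
    refine Finset.sum_congr rfl fun s _ => ?_
    rw [Matrix.mul_diagonal, Matrix.star_apply, Matrix.IsHermitian.eigenvectorUnitary_apply,
      Matrix.IsHermitian.eigenvectorUnitary_apply, Function.comp_apply]
    simp only [Complex.coe_algebraMap]
    ring
  have hc : ∀ c : Cn n [⋀^Fin 2]→L[ℝ] ℂ, constPart T c = ∑ s, (hM.1.eigenvalues s : ℂ) *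
      c ![hM.1.eigenvectorBasis s, Complex.I • hM.1.eigenvectorBasis s] := by
    intro c
    obtain ⟨C, hC⟩ := exists_coeff c
    rw [hT.constPart_eq_sum hC]
    simp only [hC, hentry, Finset.mul_sum]
    rw [Finset.sum_comm_cycle]
    refine Finset.sum_congr rfl fun s _ => Finset.sum_congr rfl fun a _ =>
      Finset.sum_congr rfl fun b _ => ?_
    ring
  refine ⟨hM.1.eigenvectorBasis, hM.1.eigenvalues, hM.eigenvalues_nonneg, ?_, hc⟩
  have h1 := hc (stdForm n)
  simp only [HolDisc.stdForm_apply_I, OrthonormalBasis.norm_eq_one, one_pow, Complex.ofReal_one,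
    mul_one] at h1
  have h2 : constPart T (stdForm n) = 1 := hT.omega
  rw [h2] at h1
  exact_mod_cast h1.symm

end IsMeanLimit

/-- On affine discs of direction `v` every translation invariant form is a multiple of `ω`. -/
theorem HolDisc.integral_constForm_affineCurve [DiscreteTopology Λ] {D : HolDisc Λ} {v p : Cn n}
    (hD : D.toFun = affineCurve Λ v p) (hv : ‖v‖ = 1) (c : Cn n [⋀^Fin 2]→L[ℝ] ℂ) {t : ℝ}
    (htR : t ≤ D.radius) :
    D.integral t (constForm Λ c) = c ![v, Complex.I • v] * D.integral t (omega Λ) := by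
  rw [D.integral_omega htR, HolDisc.energy, ← integral_complex_ofReal, HolDisc.integral,
    ← MeasureTheory.integral_const_mul]
  refine setIntegral_congr_fun measurableSet_ball fun z hz => ?_
  have hz' := ball_subset_ball htR hz
  simp only [D.pullback_apply hz', constForm_apply,
    D.deriv_affineCurve hD (ball_subset_closedBall hz'), one_smul, hv]
  simp

theorem HolDisc.jensen_constForm_affineCurve [DiscreteTopology Λ] {D : HolDisc Λ} {v p : Cn n}
    (hD : D.toFun = affineCurve Λ v p) (hv : ‖v‖ = 1) (c : Cn n [⋀^Fin 2]→L[ℝ] ℂ) :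
    D.jensen (constForm Λ c) = c ![v, Complex.I • v] * D.jensen (omega Λ) := by
  rw [HolDisc.jensen, HolDisc.jensen, ← intervalIntegral.integral_const_mul]
  refine intervalIntegral.integral_congr fun t ht => ?_
  rw [Set.uIcc_of_le D.radius_pos.le] at ht
  simp only [D.integral_constForm_affineCurve hD hv c ht.2]
  ring

theorem IsLinearCurrent.isMeanLimit [DiscreteTopology Λ] {v : Cn n} {R : currents Λ 2}
    (hR : IsLinearCurrent v R) : IsMeanLimit R := by
  obtain ⟨p, ⟨D, -, hD⟩ | ⟨D, -, hD⟩⟩ := hR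
  · exact .of_ahlforsLimit hD
  · exact .of_nevanlinnaLimit hD

theorem IsLinearCurrent.constPart_eq [DiscreteTopology Λ] {v : Cn n} (hv : ‖v‖ = 1)
    {R : currents Λ 2} (hR : IsLinearCurrent v R) (c : Cn n [⋀^Fin 2]→L[ℝ] ℂ) :
    constPart R c = c ![v, Complex.I • v] := by
  obtain ⟨p, ⟨D, hE, -, hD⟩ | ⟨D, hE, -, hD⟩⟩ := hR
  · refine tendsto_nhds_unique (hD (constForm Λ c)) (tendsto_const_nhds.congr fun j => ?_)
    rw [(D j).integral_constForm_affineCurve (hE.1 j).2 hv c le_rfl, mul_left_comm]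
    have h : ((D j).area : ℂ)⁻¹ * (D j).integral (D j).radius (omega Λ) = 1 :=
      (D j).isDiscMean_ahlforsMean.omega
    rw [h, mul_one]
  · refine tendsto_nhds_unique (hD (constForm Λ c)) (tendsto_const_nhds.congr fun j => ?_)
    rw [(D j).jensen_constForm_affineCurve (hE.1 j).2 hv c, mul_left_comm]
    have h : ((D j).nevArea : ℂ)⁻¹ * (D j).jensen (omega Λ) = 1 :=
      (D j).isDiscMean_nevanlinnaMean.omega
    rw [h, mul_one]

theorem sum_smul_mem_linearConeOne [DiscreteTopology Λ] {ι : Type} [Fintype ι] {v : ι → Cn n}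
    (hv : ∀ s, v s ≠ 0) {β : ι → ℝ} (hβ : ∀ s, 0 ≤ β s) (hsum : ∑ s, β s = 1)
    {R : ι → currents Λ 2} (hR : ∀ s, IsLinearCurrent (v s) (R s)) :
    (∑ s, (β s : ℂ) • R s) ∈ linearConeOne Λ := by
  constructor
  · refine Submodule.sum_mem _ fun s _ => ?_
    have h : (β s : ℂ) • R s = (⟨β s, hβ s⟩ : ℝ≥0) • R s := by
      ext φ
      rfl
    rw [h]
    exact Submodule.smul_mem _ _ (Submodule.subset_span ⟨v s, hv s, hR s⟩)
  · simp only [Submodule.coe_sum, Submodule.coe_smul, LinearMap.sum_apply, LinearMap.smul_apply,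
      (hR _).isMeanLimit.omega, smul_eq_mul, mul_one]
    exact_mod_cast hsum

end LinearAlgebra

end ComplexTorus

end

open ComplexTorus in
theorem proposition2p1 (n : ℕ) (Λ : Submodule ℤ (EuclideanSpace ℂ (Fin n)))
    [DiscreteTopology Λ] [IsZLattice ℝ Λ]
    (T : currents Λ 2) (hT : IsNevanlinnaCurrent T ∨ IsAhlforsCurrent T) :
    ∃ (v : OrthonormalBasis (Fin n) ℂ (EuclideanSpace ℂ (Fin n))) (β : Fin n → ℝ),
      (∀ s, 0 ≤ β s) ∧ ∑ s, β s = 1 ∧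
      -- each class `𝒯_[v_s]` has representatives, of both kinds and for every base point
      (∀ s c, (∃ A, IsAhlforsCurrentOf (affineCurve Λ (v s) c) A) ∧
        ∃ N, IsNevanlinnaCurrentOf (affineCurve Λ (v s) c) N) ∧
      -- whichever representatives are taken
      ∀ R : Fin n → currents Λ 2, (∀ s, IsLinearCurrent (v s) (R s)) →
        (∑ s, (β s : ℂ) • R s) ∈ linearConeOne Λ ∧
        Cohomologous T (∑ s, (β s : ℂ) • R s) := by
  have hlim : IsMeanLimit T := by
    rcases hT with ⟨D, hD⟩ | ⟨D, hD⟩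
    · exact .of_nevanlinnaLimit hD
    · exact .of_ahlforsLimit hD
  obtain ⟨v, β, hβ, hsum, hT'⟩ := hlim.exists_orthonormalBasis
  have hne : ∀ s, v s ≠ 0 := fun s => v.orthonormal.ne_zero s
  refine ⟨v, β, hβ, hsum, fun s c => ⟨exists_isAhlforsCurrentOf_affineCurve (hne s) c,
    exists_isNevanlinnaCurrentOf_affineCurve (hne s) c⟩, fun R hR => ?_⟩
  have happly : ∀ φ, (∑ s, (β s : ℂ) • R s).1 φ = ∑ s, (β s : ℂ) * (R s).1 φ := fun φ => by
    simp
  have hclosed : IsClosedCurrent (∑ s, (β s : ℂ) • R s) := fun φ => by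
    rw [happly]
    exact Finset.sum_eq_zero fun s _ => by
      rw [(hR s).isMeanLimit.isClosedCurrent φ, mul_zero]
  refine ⟨sum_smul_mem_linearConeOne hne hβ hsum hR, hlim.isClosedCurrent, hclosed,
    isExactCurrent_of_constForm (fun φ => ?_) fun c => ?_⟩
  · change T.1 (d φ) - (∑ s, (β s : ℂ) • R s).1 (d φ) = 0
    rw [hlim.isClosedCurrent φ, hclosed φ, sub_zero]
  · change T.1 (constForm Λ c) - (∑ s, (β s : ℂ) • R s).1 (constForm Λ c) = 0
    rw [happly, ← constPart_apply, hT', sub_eq_zero]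
    refine Finset.sum_congr rfl fun s _ => ?_
    rw [← constPart_apply, (hR s).constPart_eq (v.norm_eq_one s)]
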